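/- Let $n_d,q\in\mathbb{N}_0$, $\rho>0$, $a,q_0,q_1\in\mathbb{R}$, $g_1\in L_2((0,1);\mathbb{R}^q)$ (for example, $g_1$ piecewise continuous on $[0,1]$), $g_2,g_3\in\mathbb{R}^q$, $S_d\in\mathbb{R}^{n_d\times n_d}$ and $P_d\in\mathbb{R}^{q\times n_d}$. On the Hilbert space $X_e=\mathbb{C}^{n_d}\oplus L_2(0,1)$ with inner product $\langle x,y\rangle=x_1^{\top}\overline{y_1}+\int_0^1x_2(\zeta)\overline{y_2(\zeta)}\,d\zeta$ consider the unbounded operator $$\mathcal{A}_e\begin{pmatrix}h_1\\h_2\end{pmatrix}=\begin{pmatrix}S_dh_1\\ \rho h_2''+ah_2+g_1^{\top}P_dh_1\end{pmatrix},$$ $$D(\mathcal{A}_e)=\{(h_1,h_2)\in\mathbb{C}^{n_d}\oplus H^2(0,1)\mid h_2'(0)=q_0h_2(0)+g_2^{\top}P_dh_1,\ h_2'(1)=q_1h_2(1)+g_3^{\top}P_dh_1\}.$$ Assume that the spectrum of $\mathcal{A}_e$ is simple, i.e. every eigenvalue of $\mathcal{A}_e$ has algebraic multiplicity one. Then: 1.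 $\mathcal{A}_e$ is a Riesz-spectral operator: it is closed, its eigenvalues are simple and form a sequence $(\lambda_i)_{i\in\mathbb{N}}$ of pairwise distinct numbers, the closure of $\{\lambda_i \mid i\in\mathbb{N}\}$ is totally disconnected, and corresponding eigenvectors $(\Phi_i)_{i\in\mathbb{N}}$ form a Riesz basis of $X_e$ (their closed linear span is $X_e$, and there are $m,M>0$ with $m\sum|c_i|^2\le\|\sum c_i\Phi_i\|^2\le M\sum|c_i|^2$ for all finite families of scalars). 2. The initial boundary value problem $\dot x_e(t)=\mathcal{A}_ex_e(t)$, $t>0$, $x_e(0)=x_{e,0}\in D(\mathcal{A}_e)$, is well-posed: $\mathcal{A}_e$ is the infinitesimal generator of a $C_0$-semigroup $(\mathcal{T}_e(t))_{t\ge0}$ on $X_e$, and for every $x_{e,0}\in D(\mathcal{A}_e)$ the function $x_e(t)=\mathcal{T}_e(t)x_{e,0}$ is the unique solution, where a solution is a function that is continuous on $[0,\infty)$, takes the value $x_{e,0}$ at $t=0$, and for every $t>0$ lies in $D(\mathcal{A}_e)$, is differentiable and satisfies the differential equation. -/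

import Mathlib

open MeasureTheory Set Filter Topology
open scoped NNReal

noncomputable section

namespace ExtSys

/-! ### Unbounded operators on a Hilbert space -/

section Abstract

variable {H : Type*} [NormedAddCommGroup H] [InnerProductSpace ℂ H]

/-- `μ` is an eigenvalue of the unbounded operator `A`. -/
def IsEigenvalue (A : H →ₗ.[ℂ] H) (μ : ℂ) : Prop :=
  ∃ x : A.domain, (x : H) ≠ 0 ∧ A x = μ • (x : H)

/-- `μ` is a simple eigenvalue of `A`, that is, an eigenvalue of algebraic multiplicity one:
the eigenspace `ker (A - μ)` is one-dimensional, and there are no further generalized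
eigenvectors, i.e. `ker (A - μ) ^ 2 = ker (A - μ)`. -/
def IsSimpleEigenvalue (A : H →ₗ.[ℂ] H) (μ : ℂ) : Prop :=
  (∃ x : A.domain, (x : H) ≠ 0 ∧ A x = μ • (x : H) ∧
    ∀ y : A.domain, A y = μ • (y : H) → ∃ c : ℂ, (y : H) = c • (x : H)) ∧
  ∀ x y : A.domain, A x - μ • (x : H) = (y : H) → A y = μ • (y : H) → (y : H) = 0

/-- The spectrum of `A` is simple: every eigenvalue has algebraic multiplicity one. It is not
demanded that every point of the spectrum be an eigenvalue, so, as a hypothesis, this is implied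
by the condition that every point of the spectrum is a simple eigenvalue. -/
def HasSimpleSpectrum (A : H →ₗ.[ℂ] H) : Prop :=
  ∀ μ : ℂ, IsEigenvalue A μ → IsSimpleEigenvalue A μ

/-- A sequence is a Riesz basis: its closed linear span is the whole space, and the norm of a
finite linear combination is equivalent to the `ℓ²`-norm of its coefficients. -/
def IsRieszBasis (φ : ℕ → H) : Prop :=
  closure (Submodule.span ℂ (range φ) : Set H) = univ ∧
  ∃ m M : ℝ, 0 < m ∧ 0 < M ∧ ∀ (s : Finset ℕ) (c : ℕ → ℂ),
    m * ∑ n ∈ s, ‖c n‖ ^ 2 ≤ ‖∑ n ∈ s, c n • φ n‖ ^ 2 ∧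
    ‖∑ n ∈ s, c n • φ n‖ ^ 2 ≤ M * ∑ n ∈ s, ‖c n‖ ^ 2

/-- A Riesz-spectral operator: a closed operator whose eigenvalues are simple and can be
enumerated, without repetition, as a sequence with totally disconnected closure, such that
the corresponding eigenvectors form a Riesz basis. -/
def IsRieszSpectral (A : H →ₗ.[ℂ] H) : Prop :=
  A.IsClosed ∧
  ∃ (lam : ℕ → ℂ) (φ : ℕ → A.domain),
    Function.Injective lam ∧
    (∀ μ : ℂ, IsEigenvalue A μ ↔ ∃ n, lam n = μ) ∧
    (∀ n, IsSimpleEigenvalue A (lam n)) ∧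
    (∀ n, A (φ n) = lam n • (φ n : H)) ∧
    IsRieszBasis (fun n => (φ n : H)) ∧
    IsTotallyDisconnected (closure (range lam))

variable (H) in
/-- A strongly continuous semigroup (`C₀`-semigroup) of bounded operators. -/
structure C0Semigroup where
  /-- the operator at time `t ≥ 0` -/
  op : ℝ≥0 → H →L[ℂ] H
  op_zero : op 0 = ContinuousLinearMap.id ℂ H
  op_add : ∀ s t, op (s + t) = (op s).comp (op t)
  tendsto_zero : ∀ x, Tendsto (fun t => op t x) (𝓝 0) (𝓝 x)

/-- `A` is the infinitesimal generator of `T`: `x ∈ D(A)` and `A x = y` if and only if the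
difference quotients `(T(t) x - x) / t` converge to `y` as `t` decreases to `0`. -/
def IsGenerator (T : C0Semigroup H) (A : H →ₗ.[ℂ] H) : Prop :=
  ∀ x y : H, (x, y) ∈ A.graph ↔
    Tendsto (fun t : ℝ≥0 => (((t : ℝ) : ℂ))⁻¹ • (T.op t x - x)) (𝓝[>] 0) (𝓝 y)

/-- `x` is a solution of `x'(t) = A x(t)`, `t > 0`, `x(0) = x₀`. -/
def IsSolution (A : H →ₗ.[ℂ] H) (x₀ : H) (x : ℝ → H) : Prop :=
  ContinuousOn x (Ici 0) ∧ x 0 = x₀ ∧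
    ∀ t : ℝ, 0 < t → ∃ y : H, (x t, y) ∈ A.graph ∧ HasDerivAt x y t

/-- Well-posedness of `x'(t) = A x(t)`, `t > 0`, `x(0) = x₀ ∈ D(A)`: the operator `A` generates
a `C₀`-semigroup `T`, and for every `x₀ ∈ D(A)` the function `t ↦ T(t) x₀` is the one and only
solution. -/
def IsWellPosed (A : H →ₗ.[ℂ] H) : Prop :=
  ∃ T : C0Semigroup H, IsGenerator T A ∧
    ∀ x₀ ∈ A.domain,
      IsSolution A x₀ (fun t => T.op t.toNNReal x₀) ∧
      ∀ x : ℝ → H, IsSolution A x₀ x → ∀ t : ℝ, 0 ≤ t → x t = T.op t.toNNReal x₀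

end Abstract

/-! ### The state space and the operator of the coupled system -/

/-- The complex Hilbert space `L₂(0,1)`. -/
abbrev L2 : Type := Lp ℂ 2 (volume.restrict (Ioo (0 : ℝ) 1))

/-- The Hilbert space `ℂⁿ ⊕ L₂(0,1)`. -/
abbrev State (n : ℕ) : Type := WithLp 2 (EuclideanSpace ℂ (Fin n) × L2)

/-- `h ∈ H²(0,1)`, with `h'' = w`, where `u` is the continuously differentiable representative
of `h` on `[0,1]` and `v` its derivative, which is absolutely continuous with density `w`. -/
structure IsH2 (h w : L2) (u v : ℝ → ℂ) : Prop where
  ae_eq : ∀ᵐ z ∂(volume.restrict (Ioo (0 : ℝ) 1)), h z = u z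
  fst_deriv : ∀ z ∈ Icc (0 : ℝ) 1, HasDerivWithinAt u (v z) (Icc 0 1) z
  snd_deriv : ∀ z ∈ Icc (0 : ℝ) 1, v z = v 0 + ∫ s in (0 : ℝ)..z, w s

lemma L2.intervalIntegrable (w : L2) : IntervalIntegrable (w : ℝ → ℂ) volume 0 1 := by
  rw [intervalIntegrable_iff_integrableOn_Ioo_of_le zero_le_one]
  exact (Lp.memLp w).integrable (by norm_num)

lemma L2.intervalIntegrable' (w : L2) {z : ℝ} (hz : z ∈ Icc (0 : ℝ) 1) :
    IntervalIntegrable (w : ℝ → ℂ) volume 0 z := by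
  refine (L2.intervalIntegrable w).mono_set ?_
  rw [uIcc_of_le hz.1, uIcc_of_le zero_le_one]
  exact Icc_subset_Icc le_rfl hz.2

lemma IsH2.zero : IsH2 0 0 (fun _ => 0) (fun _ => 0) where
  ae_eq := Lp.coeFn_zero ℂ 2 _
  fst_deriv z _ := hasDerivWithinAt_const z _ 0
  snd_deriv z hz := by
    have h : ∫ s in (0 : ℝ)..z, (0 : L2) s = ∫ s in (0 : ℝ)..z, (0 : ℂ) := by
      refine intervalIntegral.integral_congr_ae_restrict ?_
      rw [uIoc_of_le hz.1, ← restrict_Ioo_eq_restrict_Ioc]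
      exact ae_restrict_of_ae_restrict_of_subset (Ioo_subset_Ioo le_rfl hz.2)
        (Lp.coeFn_zero ℂ 2 (volume.restrict (Ioo (0 : ℝ) 1)))
    rw [h]
    simp

lemma IsH2.add {h w h' w' : L2} {u v u' v' : ℝ → ℂ} (H : IsH2 h w u v) (H' : IsH2 h' w' u' v') :
    IsH2 (h + h') (w + w') (fun z => u z + u' z) (fun z => v z + v' z) where
  ae_eq := by
    filter_upwards [Lp.coeFn_add h h', H.ae_eq, H'.ae_eq] with z h1 h2 h3
    rw [h1, Pi.add_apply, h2, h3]
  fst_deriv z hz := (H.fst_deriv z hz).add (H'.fst_deriv z hz)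
  snd_deriv z hz := by
    have h : ∫ s in (0 : ℝ)..z, (w + w') s = ∫ s in (0 : ℝ)..z, (w s + w' s) := by
      refine intervalIntegral.integral_congr_ae_restrict ?_
      rw [uIoc_of_le hz.1, ← restrict_Ioo_eq_restrict_Ioc]
      exact ae_restrict_of_ae_restrict_of_subset (Ioo_subset_Ioo le_rfl hz.2)
        (Lp.coeFn_add w w')
    rw [h, intervalIntegral.integral_add (L2.intervalIntegrable' w hz)
      (L2.intervalIntegrable' w' hz), H.snd_deriv z hz, H'.snd_deriv z hz]
    ring

lemma IsH2.smul {h w : L2} {u v : ℝ → ℂ} (c : ℂ) (H : IsH2 h w u v) :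
    IsH2 (c • h) (c • w) (fun z => c * u z) (fun z => c * v z) where
  ae_eq := by
    filter_upwards [Lp.coeFn_smul c h, H.ae_eq] with z h1 h2
    rw [h1, Pi.smul_apply, h2, smul_eq_mul]
  fst_deriv z hz := (H.fst_deriv z hz).const_mul c
  snd_deriv z hz := by
    have h : ∫ s in (0 : ℝ)..z, (c • w) s = ∫ s in (0 : ℝ)..z, c * w s := by
      refine intervalIntegral.integral_congr_ae_restrict ?_
      rw [uIoc_of_le hz.1, ← restrict_Ioo_eq_restrict_Ioc]
      exact ae_restrict_of_ae_restrict_of_subset (Ioo_subset_Ioo le_rfl hz.2)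
        (Lp.coeFn_smul c w)
    rw [h, intervalIntegral.integral_const_mul, H.snd_deriv z hz]
    ring

/-- The second derivative is determined by the function. -/
lemma IsH2.eq_zero {w : L2} {u v : ℝ → ℂ} (H : IsH2 0 w u v) : w = 0 := by
  have hu : EqOn u (fun _ => (0 : ℂ)) (Icc 0 1) := by
    refine Measure.eqOn_Icc_of_ae_eq volume zero_ne_one ?_
      (fun z hz => (H.fst_deriv z hz).continuousWithinAt) continuousOn_const
    rw [← restrict_Ioo_eq_restrict_Icc]
    filter_upwards [H.ae_eq, Lp.coeFn_zero ℂ 2 (volume.restrict (Ioo (0 : ℝ) 1))] with z h1 h2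
    rw [← h1, h2]
    rfl
  have hv : ∀ z ∈ Icc (0 : ℝ) 1, v z = 0 := fun z hz => by
    have h1 : HasDerivWithinAt (fun _ : ℝ => (0 : ℂ)) (v z) (Icc 0 1) z :=
      (H.fst_deriv z hz).congr (fun y hy => (hu hy).symm) (hu hz).symm
    exact (uniqueDiffOn_Icc zero_lt_one z hz).eq_deriv _ h1 (hasDerivWithinAt_const z _ 0)
  have hw : ∀ z ∈ Icc (0 : ℝ) 1, ∫ s in (0 : ℝ)..z, w s = 0 := fun z hz => by
    have := H.snd_deriv z hz
    rw [hv z hz, hv 0 ⟨le_rfl, zero_le_one⟩] at this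
    simpa using this.symm
  refine (Lp.eq_zero_iff_ae_eq_zero).2 ?_
  refine (ae_restrict_iff' measurableSet_Ioo).2 ?_
  filter_upwards [(L2.intervalIntegrable w).ae_hasDerivAt_integral] with z hz hz01
  have hz' : z ∈ uIcc (0 : ℝ) 1 := by
    rw [uIcc_of_le zero_le_one]; exact Ioo_subset_Icc_self hz01
  have h1 := hz hz' 0 (by simp)
  have h2 : HasDerivAt (fun _ : ℝ => (0 : ℂ)) (w z) z := by
    refine h1.congr_of_eventuallyEq ?_
    filter_upwards [Ioo_mem_nhds hz01.1 hz01.2] with y hy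
    exact (hw y (Ioo_subset_Icc_self hy)).symm
  exact h2.unique (hasDerivAt_const z 0)

/-- The real matrix `P` acting on a complex vector. -/
def act {m n : ℕ} (P : Matrix (Fin m) (Fin n) ℝ) (ω : EuclideanSpace ℂ (Fin n)) (i : Fin m) : ℂ :=
  ∑ j, (P i j : ℂ) * ω j

/-- `gᵀ P ω` for a real vector `g`. -/
def pair {m n : ℕ} (g : Fin m → ℝ) (P : Matrix (Fin m) (Fin n) ℝ)
    (ω : EuclideanSpace ℂ (Fin n)) : ℂ :=
  ∑ i, (g i : ℂ) * act P ω i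

lemma act_zero {m n : ℕ} (P : Matrix (Fin m) (Fin n) ℝ) (i : Fin m) : act P 0 i = 0 := by
  simp [act]

lemma act_add {m n : ℕ} (P : Matrix (Fin m) (Fin n) ℝ) (x y : EuclideanSpace ℂ (Fin n))
    (i : Fin m) : act P (x + y) i = act P x i + act P y i := by
  simp [act, mul_add, Finset.sum_add_distrib]

lemma act_smul {m n : ℕ} (P : Matrix (Fin m) (Fin n) ℝ) (c : ℂ) (x : EuclideanSpace ℂ (Fin n))
    (i : Fin m) : act P (c • x) i = c * act P x i := by
  simp [act, Finset.mul_sum, mul_left_comm]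

lemma pair_zero {m n : ℕ} (g : Fin m → ℝ) (P : Matrix (Fin m) (Fin n) ℝ) : pair g P 0 = 0 := by
  simp [pair, act_zero]

lemma pair_add {m n : ℕ} (g : Fin m → ℝ) (P : Matrix (Fin m) (Fin n) ℝ)
    (x y : EuclideanSpace ℂ (Fin n)) : pair g P (x + y) = pair g P x + pair g P y := by
  simp [pair, act_add, mul_add, Finset.sum_add_distrib]

lemma pair_smul {m n : ℕ} (g : Fin m → ℝ) (P : Matrix (Fin m) (Fin n) ℝ) (c : ℂ)
    (x : EuclideanSpace ℂ (Fin n)) : pair g P (c • x) = c * pair g P x := by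
  simp [pair, act_smul, Finset.mul_sum, mul_left_comm]

/-- The relation `h ∈ D(Aₑ)` and `Aₑ h = k` : `h = (h₁, h₂)` with `h₂ ∈ H²(0,1)`,
`h₂'(0) = q₀ h₂(0) + g₂ᵀ P h₁`, `h₂'(1) = q₁ h₂(1) + g₃ᵀ P h₁`, and
`k = (S h₁, ρ h₂'' + a h₂ + g₁ᵀ P h₁)`. -/
def ExtRel {nd q : ℕ} (ρ a q₀ q₁ : ℝ) (g₁ : ℝ → Fin q → ℝ) (g₂ g₃ : Fin q → ℝ)
    (S : Matrix (Fin nd) (Fin nd) ℝ) (P : Matrix (Fin q) (Fin nd) ℝ) (h k : State nd) : Prop :=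
  ∃ (w : L2) (u v : ℝ → ℂ), IsH2 h.snd w u v ∧
    v 0 = q₀ * u 0 + pair g₂ P h.fst ∧
    v 1 = q₁ * u 1 + pair g₃ P h.fst ∧
    (∀ i, k.fst i = act S h.fst i) ∧
    ∀ᵐ z ∂(volume.restrict (Ioo (0 : ℝ) 1)),
      k.snd z = ρ * w z + a * h.snd z + pair (g₁ z) P h.fst

/-- The graph of `Aₑ`, as a linear subspace of `Xₑ × Xₑ`. -/
def extGraph {nd q : ℕ} (ρ a q₀ q₁ : ℝ) (g₁ : ℝ → Fin q → ℝ) (g₂ g₃ : Fin q → ℝ)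
    (S : Matrix (Fin nd) (Fin nd) ℝ) (P : Matrix (Fin q) (Fin nd) ℝ) :
    Submodule ℂ (State nd × State nd) where
  carrier := {p | ExtRel ρ a q₀ q₁ g₁ g₂ g₃ S P p.1 p.2}
  zero_mem' := by
    refine ⟨0, _, _, IsH2.zero, ?_, ?_, ?_, ?_⟩
    · simp [pair_zero]
    · simp [pair_zero]
    · intro i; simp [act_zero]
    · filter_upwards [Lp.coeFn_zero ℂ 2 (volume.restrict (Ioo (0 : ℝ) 1))] with z hz
      simp only [Prod.fst_zero, Prod.snd_zero, WithLp.zero_fst, WithLp.zero_snd, pair_zero, hz,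
        Pi.zero_apply, mul_zero, add_zero]
  add_mem' := by
    rintro p p' ⟨w, u, v, H, h0, h1, hS, hk⟩ ⟨w', u', v', H', h0', h1', hS', hk'⟩
    refine ⟨w + w', _, _, H.add H', ?_, ?_, ?_, ?_⟩
    · simp only [h0, h0', Prod.fst_add, WithLp.add_fst, pair_add]; ring
    · simp only [h1, h1', Prod.fst_add, WithLp.add_fst, pair_add]; ring
    · intro i
      simp [hS, hS', act_add]
    · filter_upwards [hk, hk', Lp.coeFn_add w w', Lp.coeFn_add p.1.snd p'.1.snd,
        Lp.coeFn_add p.2.snd p'.2.snd] with z e e' e1 e2 e3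
      simp only [Prod.fst_add, Prod.snd_add, WithLp.add_snd, WithLp.add_fst, e1, e2, e3,
        Pi.add_apply, e, e', pair_add]
      ring
  smul_mem' := by
    rintro c p ⟨w, u, v, H, h0, h1, hS, hk⟩
    refine ⟨c • w, _, _, H.smul c, ?_, ?_, ?_, ?_⟩
    · simp only [h0, Prod.smul_fst, WithLp.smul_fst, pair_smul]; ring
    · simp only [h1, Prod.smul_fst, WithLp.smul_fst, pair_smul]; ring
    · intro i
      simp [hS, act_smul]
    · filter_upwards [hk, Lp.coeFn_smul c w, Lp.coeFn_smul c p.1.snd,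
        Lp.coeFn_smul c p.2.snd] with z e e1 e2 e3
      simp only [Prod.smul_fst, Prod.smul_snd, WithLp.smul_snd, WithLp.smul_fst, e1, e2, e3,
        Pi.smul_apply, e, pair_smul, smul_eq_mul]
      ring

lemma extGraph_functional {nd q : ℕ} (ρ a q₀ q₁ : ℝ) (g₁ : ℝ → Fin q → ℝ) (g₂ g₃ : Fin q → ℝ)
    (S : Matrix (Fin nd) (Fin nd) ℝ) (P : Matrix (Fin q) (Fin nd) ℝ)
    (p : State nd × State nd) (hp : p ∈ extGraph ρ a q₀ q₁ g₁ g₂ g₃ S P) (h0 : p.1 = 0) :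
    p.2 = 0 := by
  obtain ⟨w, u, v, H, -, -, hS, hk⟩ := hp
  rw [h0] at H hS hk
  have hw : w = 0 := IsH2.eq_zero (by simpa using H)
  refine (WithLp.ofLp_injective 2) (Prod.ext ?_ ?_)
  · ext i
    simpa [act_zero] using hS i
  · refine (Lp.eq_zero_iff_ae_eq_zero).2 ?_
    filter_upwards [hk, Lp.coeFn_zero ℂ 2 (volume.restrict (Ioo (0 : ℝ) 1))] with z e e0
    have : p.2.snd z = 0 := by
      rw [e, hw]
      simp only [WithLp.zero_fst, WithLp.zero_snd, pair_zero, e0, Pi.zero_apply, mul_zero,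
        add_zero]
    simpa using this

/-- The operator `Aₑ` of the coupled system, as an unbounded operator on `ℂⁿ ⊕ L₂(0,1)`. -/
def extOp {nd q : ℕ} (ρ a q₀ q₁ : ℝ) (g₁ : ℝ → Fin q → ℝ) (g₂ g₃ : Fin q → ℝ)
    (S : Matrix (Fin nd) (Fin nd) ℝ) (P : Matrix (Fin q) (Fin nd) ℝ) :
    State nd →ₗ.[ℂ] State nd :=
  (extGraph ρ a q₀ q₁ g₁ g₂ g₃ S P).toLinearPMap

/-- `(h, k)` lies on the graph of `Aₑ` exactly when the defining relation holds. -/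
lemma mem_graph_extOp {nd q : ℕ} (ρ a q₀ q₁ : ℝ) (g₁ : ℝ → Fin q → ℝ) (g₂ g₃ : Fin q → ℝ)
    (S : Matrix (Fin nd) (Fin nd) ℝ) (P : Matrix (Fin q) (Fin nd) ℝ) (h k : State nd) :
    (h, k) ∈ (extOp ρ a q₀ q₁ g₁ g₂ g₃ S P).graph ↔ ExtRel ρ a q₀ q₁ g₁ g₂ g₃ S P h k := by
  rw [extOp, Submodule.toLinearPMap_graph_eq _ (extGraph_functional ρ a q₀ q₁ g₁ g₂ g₃ S P)]
  rfl

end ExtSys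

end

/-! The operator is diagonalised by an explicit bounded change of coordinates from `ℓ²`; after that,
every claim can be checked coordinate by coordinate.

Choose maps `B x` in H², linear in `x`, that absorb the inhomogeneous boundary terms. Then `h₂ - B
h₁` satisfies homogeneous Robin conditions, and `Aₑ h = k` reads `k₁ = S h₁`, `k₂ - N h₁ = A₀ (h₂ -
B h₁)` with `A₀ = ρ d²/dz² + a` (`extRel_iff`, `IsTriangular`). A resolvent of the Robin Laplacian
is compact, symmetric and injective with one-dimensional eigenspaces. Hence `A₀` has an orthonormal
eigenbasis with distinct real eigenvalues `μₙ`, bounded above and unbounded in modulus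
(`exists_robin_eigenbasis`).

Simplicity of the spectrum enters twice. An eigenvalue shared by `S` and `A₀` would produce a Jordan
chain or a two-dimensional eigenspace (`eigenvalue_ne`). Without shared eigenvalues, eigenvectors
and Jordan chains of `S` lift to `Aₑ`, so `S` is diagonalisable with distinct eigenvalues
(`IsTriangular.exists_basis`). The Sylvester equation `M S - N = A₀ (M - B)` is then solvable on the
eigenbasis of `S`, and the shear `y ↦ y - M x` decouples the two blocks
(`IsTriangular.exists_isDiagonal`).

For a diagonal operator the images of the unit vectors form a Riesz basis of eigenvectors, and the
semigroup multiplies the coordinates by `exp (t λᵢ)` (`IsDiagonal.isRieszSpectral`,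
`IsDiagonal.isWellPosed`). -/

open MeasureTheory Set Filter Topology
open scoped NNReal

noncomputable section

namespace ExtSys

/-! ### Diagonal operators on `ℓ²` -/

section Diagonal

variable {ι : Type*}

/-- Evaluation of an `ℓ²` sequence at an index, as a continuous functional. -/
def coordCLM (i : ι) : lp (fun _ : ι => ℂ) 2 →L[ℂ] ℂ :=
  LinearMap.mkContinuous (lp.evalₗ (𝕜 := ℂ) (fun _ : ι => ℂ) 2 i) 1 fun z => by
    rw [one_mul]
    exact lp.norm_apply_le_norm (by norm_num) z i

lemma coordCLM_apply (i : ι) (x : lp (fun _ : ι => ℂ) 2) : coordCLM i x = x i := rfl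

lemma memℓp_bounded_mul {m : ι → ℂ} {C : ℝ} (hm : ∀ i, ‖m i‖ ≤ C)
    (x : lp (fun _ : ι => ℂ) 2) : Memℓp (fun i => m i * x i) 2 := by
  refine ((lp.memℓp x).const_smul (C : ℂ)).mono' fun i => ?_
  rw [norm_mul, Pi.smul_apply, norm_smul, Complex.norm_real, Real.norm_eq_abs]
  exact mul_le_mul_of_nonneg_right ((hm i).trans (le_abs_self C)) (norm_nonneg _)

/-- Multiplication by a bounded sequence, as a bounded operator on `ℓ²`. -/
def diagMul (m : ι → ℂ) {C : ℝ} (hm : ∀ i, ‖m i‖ ≤ C) :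
    lp (fun _ : ι => ℂ) 2 →L[ℂ] lp (fun _ : ι => ℂ) 2 :=
  LinearMap.mkContinuous
    { toFun := fun x => ⟨fun i => m i * x i, memℓp_bounded_mul hm x⟩
      map_add' := fun x y => by
        ext i
        exact mul_add _ _ _
      map_smul' := fun c x => by
        ext i
        exact mul_left_comm _ _ _ } |C| fun x => by
      have h : ‖(⟨fun i => m i * x i, memℓp_bounded_mul hm x⟩ : lp (fun _ : ι => ℂ) 2)‖
          ≤ ‖(C : ℂ) • x‖ := by
        refine lp.norm_mono (by norm_num) fun i => ?_
        rw [lp.coeFn_smul, Pi.smul_apply, norm_smul, Complex.norm_real, Real.norm_eq_abs]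
        change ‖m i * x i‖ ≤ _
        rw [norm_mul]
        exact mul_le_mul_of_nonneg_right ((hm i).trans (le_abs_self C)) (norm_nonneg _)
      rwa [norm_smul, Complex.norm_real, Real.norm_eq_abs] at h

@[simp]
lemma diagMul_apply (m : ι → ℂ) {C : ℝ} (hm : ∀ i, ‖m i‖ ≤ C) (x : lp (fun _ : ι => ℂ) 2)
    (i : ι) : diagMul m hm x i = m i * x i := rfl

lemma norm_exp_mul_le {z : ℂ} {ω t : ℝ} (hz : z.re ≤ ω) (ht : 0 ≤ t) :
    ‖Complex.exp (t * z)‖ ≤ Real.exp (t * ω) := by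
  rw [Complex.norm_exp, Complex.re_ofReal_mul]
  exact Real.exp_le_exp.2 (mul_le_mul_of_nonneg_left hz ht)

/-- The operator `x ↦ (exp (t λᵢ) xᵢ)ᵢ` on `ℓ²`. -/
def diagExp (lam : ι → ℂ) {ω : ℝ} (hω : ∀ i, (lam i).re ≤ ω) (t : ℝ≥0) :
    lp (fun _ : ι => ℂ) 2 →L[ℂ] lp (fun _ : ι => ℂ) 2 :=
  diagMul (fun i => Complex.exp ((t : ℝ) * lam i)) fun i => norm_exp_mul_le (hω i) t.2

@[simp]
lemma diagExp_apply (lam : ι → ℂ) {ω : ℝ} (hω : ∀ i, (lam i).re ≤ ω) (t : ℝ≥0)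
    (x : lp (fun _ : ι => ℂ) 2) (i : ι) :
    diagExp lam hω t x i = Complex.exp ((t : ℝ) * lam i) * x i := rfl

/-- Dominated convergence for the series of squares: near `t₀` the `i`-th term is at most `K ^ 2 *
‖x i‖ ^ 2`, the factor 2 in `K` covering the two exponentials. -/
lemma continuous_diagExp (lam : ι → ℂ) {ω : ℝ} (hω : ∀ i, (lam i).re ≤ ω)
    (x : lp (fun _ : ι => ℂ) 2) : Continuous fun t => diagExp lam hω t x := by
  rw [continuous_iff_continuousAt]
  intro t₀
  rw [ContinuousAt, tendsto_iff_norm_sub_tendsto_zero]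
  set K : ℝ := 2 * Real.exp ((t₀ + 1) * |ω|) with hK
  have h2 : (0 : ℝ) < (2 : ENNReal).toReal := by norm_num
  have hsq : ∀ y : lp (fun _ : ι => ℂ) 2, ‖y‖ ^ 2 = ∑' i, ‖y i‖ ^ 2 := fun y => by
    simpa using lp.norm_rpow_eq_tsum h2 y
  have hsum : Summable fun i => K ^ 2 * ‖x i‖ ^ 2 := by
    simpa using ((lp.memℓp x).summable h2).mul_left (K ^ 2)
  have hb : ∀ t : ℝ≥0, (t : ℝ) ≤ t₀ + 1 → ∀ i,
      ‖Complex.exp ((t : ℝ) * lam i)‖ ≤ Real.exp ((t₀ + 1) * |ω|) := fun t ht i =>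
    (norm_exp_mul_le (hω i) t.2).trans <| Real.exp_le_exp.2 <|
      (mul_le_mul_of_nonneg_left (le_abs_self ω) t.2).trans
        (mul_le_mul_of_nonneg_right ht (abs_nonneg ω))
  have key : Tendsto (fun t : ℝ≥0 => ∑' i, ‖(diagExp lam hω t x - diagExp lam hω t₀ x) i‖ ^ 2)
      (𝓝 t₀) (𝓝 (∑' _ : ι, (0 : ℝ))) := by
    refine tendsto_tsum_of_dominated_convergence hsum (fun i => ?_) ?_
    · have : Continuous fun t : ℝ≥0 =>
          ‖Complex.exp ((t : ℝ) * lam i) * x i - Complex.exp ((t₀ : ℝ) * lam i) * x i‖ ^ 2 := by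
        fun_prop
      simpa using this.tendsto t₀
    · have : ∀ᶠ t : ℝ≥0 in 𝓝 t₀, t < t₀ + 1 :=
        eventually_lt_nhds (lt_add_of_pos_right _ zero_lt_one)
      filter_upwards [this] with t ht i
      have ht' : (t : ℝ) ≤ t₀ + 1 := by exact_mod_cast ht.le
      rw [Real.norm_of_nonneg (by positivity), ← mul_pow]
      refine pow_le_pow_left₀ (norm_nonneg _) ?_ 2
      change ‖Complex.exp ((t : ℝ) * lam i) * x i - Complex.exp ((t₀ : ℝ) * lam i) * x i‖ ≤ _
      rw [← sub_mul, norm_mul]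
      refine mul_le_mul_of_nonneg_right ((norm_sub_le _ _).trans ?_) (norm_nonneg _)
      have h1 := hb t ht' i
      have h2 := hb t₀ (by linarith) i
      linarith
  rw [tsum_zero] at key
  have := key.sqrt
  simp_rw [← hsq, Real.sqrt_zero] at this
  simpa only [Real.sqrt_sq (norm_nonneg _)] using this

/-- Evaluation at a coordinate commutes with the integral and leaves the fundamental theorem for a
scalar exponential. The integral form gives differentiability of orbits without estimating
difference quotients in `ℓ²`. -/
lemma diagExp_eq_add_integral (lam : ι → ℂ) {ω : ℝ} (hω : ∀ i, (lam i).re ≤ ω)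
    {x y : lp (fun _ : ι => ℂ) 2} (hxy : ∀ i, y i = lam i * x i) {t : ℝ} (ht : 0 ≤ t) :
    diagExp lam hω t.toNNReal x = x + ∫ s in (0 : ℝ)..t, diagExp lam hω s.toNNReal y := by
  ext i
  have hc : Continuous fun s : ℝ => diagExp lam hω s.toNNReal y :=
    (continuous_diagExp lam hω y).comp continuous_real_toNNReal
  let L : lp (fun _ : ι => ℂ) 2 →L[ℂ] ℂ := coordCLM i
  have hL := L.intervalIntegral_comp_comm (hc.intervalIntegrable (μ := volume) 0 t)
  have hd : ∀ s : ℝ, HasDerivAt (fun s : ℝ => Complex.exp (s * lam i) * x i)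
      (Complex.exp (s * lam i) * (lam i * x i)) s := fun s => by
    have h := ((((hasDerivAt_id s).ofReal_comp).mul_const (lam i)).cexp).mul_const (x i)
    simp only [id, Complex.ofReal_one, one_mul] at h
    rwa [mul_assoc] at h
  have hI := intervalIntegral.integral_eq_sub_of_hasDerivAt (a := 0) (b := t) (fun s _ => hd s)
    ((by fun_prop : Continuous _).intervalIntegrable 0 t)
  have hI' : ∫ s in (0 : ℝ)..t, L (diagExp lam hω s.toNNReal y)
      = ∫ s in (0 : ℝ)..t, Complex.exp (s * lam i) * (lam i * x i) := by
    refine intervalIntegral.integral_congr fun s hs => ?_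
    rw [uIcc_of_le ht] at hs
    change Complex.exp ((s.toNNReal : ℝ) * lam i) * y i = _
    rw [Real.coe_toNNReal s hs.1, hxy]
  rw [hI', hI] at hL
  rw [lp.coeFn_add, Pi.add_apply, diagExp_apply, ← coordCLM_apply i (∫ s in (0 : ℝ)..t, _), ← hL,
    Real.coe_toNNReal t ht]
  simp

end Diagonal

/-! ### Operators diagonalised by an isomorphism with `ℓ²`: spectrum and Riesz basis -/

section Abstract

variable {H : Type*} [NormedAddCommGroup H] [InnerProductSpace ℂ H] {ι : Type*}

/-- The operator `A` is diagonal in the coordinates given by `Ψ`. -/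
def IsDiagonal (A : H →ₗ.[ℂ] H) (Ψ : lp (fun _ : ι => ℂ) 2 ≃L[ℂ] H) (lam : ι → ℂ) : Prop :=
  ∀ x y : H, (x, y) ∈ A.graph ↔ ∀ i, Ψ.symm y i = lam i * Ψ.symm x i

variable {A : H →ₗ.[ℂ] H} {Ψ : lp (fun _ : ι => ℂ) 2 ≃L[ℂ] H} {lam : ι → ℂ}

lemma IsDiagonal.apply_iff (hA : IsDiagonal A Ψ lam) (x : A.domain) (y : H) :
    A x = y ↔ ∀ i, Ψ.symm y i = lam i * Ψ.symm (x : H) i := by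
  rw [← hA, LinearPMap.mem_graph_iff]
  constructor
  · intro h
    exact ⟨x, rfl, h⟩
  · rintro ⟨z, hz, hzy⟩
    rwa [Subtype.ext hz] at hzy

lemma continuous_coord (Ψ : lp (fun _ : ι => ℂ) 2 ≃L[ℂ] H) (i : ι) :
    Continuous fun x : H => Ψ.symm x i :=
  (lp.lipschitzWith_one_eval (E := fun _ : ι => ℂ) 2 i).continuous.comp Ψ.symm.continuous

lemma IsDiagonal.isClosed (hA : IsDiagonal A Ψ lam) : A.IsClosed := by
  have : (A.graph : Set (H × H)) = ⋂ i, {p : H × H | Ψ.symm p.2 i = lam i * Ψ.symm p.1 i} := by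
    ext ⟨x, y⟩
    simp [hA x y]
  rw [LinearPMap.IsClosed, this]
  exact isClosed_iInter fun i => isClosed_eq ((continuous_coord Ψ i).comp continuous_snd)
    (continuous_const.mul ((continuous_coord Ψ i).comp continuous_fst))

lemma IsDiagonal.eigen_iff (hA : IsDiagonal A Ψ lam) (x : A.domain) (μ : ℂ) :
    A x = μ • (x : H) ↔ ∀ i, lam i ≠ μ → Ψ.symm (x : H) i = 0 := by
  rw [hA.apply_iff]
  refine forall_congr' fun i => ?_
  rw [map_smul, lp.coeFn_smul, Pi.smul_apply, smul_eq_mul, eq_comm, mul_eq_mul_right_iff,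
    or_iff_not_imp_left]

open scoped Classical in
/-- The eigenvector of a diagonal operator with index `i`. -/
def diagVec (Ψ : lp (fun _ : ι => ℂ) 2 ≃L[ℂ] H) (i : ι) : H :=
  Ψ (lp.single 2 i (1 : ℂ))

lemma IsDiagonal.diagVec_mem_graph (hA : IsDiagonal A Ψ lam) (i : ι) :
    (diagVec Ψ i, lam i • diagVec Ψ i) ∈ A.graph := by
  classical
  rw [hA]
  intro j
  rw [map_smul, lp.coeFn_smul, Pi.smul_apply, smul_eq_mul, diagVec,
    ContinuousLinearEquiv.symm_apply_apply]
  rcases eq_or_ne j i with rfl | h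
  · rfl
  · rw [lp.single_apply_ne _ _ _ h, mul_zero, mul_zero]

lemma diagVec_ne_zero (Ψ : lp (fun _ : ι => ℂ) 2 ≃L[ℂ] H) (i : ι) : diagVec Ψ i ≠ 0 := by
  classical
  intro h
  have h1 : lp.single 2 i (1 : ℂ) = (0 : lp (fun _ : ι => ℂ) 2) := by
    simpa [diagVec] using h
  have h2 := congrArg (fun z : lp (fun _ : ι => ℂ) 2 => z i) h1
  simp at h2

lemma IsDiagonal.isEigenvalue_iff (hA : IsDiagonal A Ψ lam) (μ : ℂ) :
    IsEigenvalue A μ ↔ ∃ i, lam i = μ := by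
  constructor
  · rintro ⟨x, hx0, hx⟩
    by_contra! h
    refine hx0 ((map_eq_zero_iff Ψ.symm Ψ.symm.injective).1 ?_)
    ext i
    exact (hA.eigen_iff x μ).1 hx i (h i)
  · rintro ⟨i, rfl⟩
    obtain ⟨x, hx, hx'⟩ := (LinearPMap.mem_graph_iff A).1 (hA.diagVec_mem_graph i)
    exact ⟨x, by rw [hx]; exact diagVec_ne_zero Ψ i, by rw [hx', hx]⟩

/-- Since the `lam j` are distinct, an eigenvector for `lam i` has only its `i`-th coordinate. That
coordinate of `A x - lam i • x` always vanishes, which rules out Jordan chains. -/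
lemma IsDiagonal.isSimpleEigenvalue (hA : IsDiagonal A Ψ lam) (hinj : Function.Injective lam)
    (i : ι) : IsSimpleEigenvalue A (lam i) := by
  classical
  obtain ⟨x, hx, hx'⟩ := (LinearPMap.mem_graph_iff A).1 (hA.diagVec_mem_graph i)
  simp only at hx hx'
  refine ⟨⟨x, by rw [hx]; exact diagVec_ne_zero Ψ i, by rw [hx', hx], fun y hy => ?_⟩, ?_⟩
  · have h := (hA.eigen_iff y _).1 hy
    refine ⟨Ψ.symm (y : H) i, Ψ.symm.injective ?_⟩
    rw [hx, map_smul, diagVec, ContinuousLinearEquiv.symm_apply_apply]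
    ext j
    rw [lp.coeFn_smul, Pi.smul_apply, smul_eq_mul]
    rcases eq_or_ne j i with rfl | hj
    · rw [lp.single_apply_self, mul_one]
    · rw [lp.single_apply_ne _ _ _ hj, mul_zero, h j (hinj.ne hj)]
  · intro x y hxy hy
    have h := (hA.eigen_iff y _).1 hy
    have h' := (hA.apply_iff x _).1 (sub_eq_iff_eq_add.1 hxy) i
    have h0 : Ψ.symm (y : H) i = 0 := by
      rw [map_add, map_smul, lp.coeFn_add, lp.coeFn_smul, Pi.add_apply, Pi.smul_apply,
        smul_eq_mul] at h'
      simpa using h'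
    refine (map_eq_zero_iff Ψ.symm Ψ.symm.injective).1 ?_
    ext j
    rcases eq_or_ne j i with rfl | hj
    · exact h0
    · exact h j (hinj.ne hj)

lemma norm_sq_sum_single [DecidableEq ι] (s : Finset ι) (c : ι → ℂ) :
    ‖∑ i ∈ s, c i • (lp.single 2 i (1 : ℂ) : lp (fun _ : ι => ℂ) 2)‖ ^ 2
      = ∑ i ∈ s, ‖c i‖ ^ 2 := by
  have h := lp.norm_sum_single (E := fun _ : ι => ℂ) (p := 2) (by norm_num) c s
  have h1 : ∀ i, c i • (lp.single 2 i (1 : ℂ) : lp (fun _ : ι => ℂ) 2) = lp.single 2 i (c i) :=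
    fun i => by rw [← lp.single_smul, smul_eq_mul, mul_one]
  simp_rw [h1]
  simpa using h

lemma isRieszBasis_diagVec (Ψ : lp (fun _ : ι => ℂ) 2 ≃L[ℂ] H) (e : ℕ ≃ ι) :
    IsRieszBasis fun n => diagVec Ψ (e n) := by
  classical
  constructor
  · rw [← Submodule.topologicalClosure_coe]
    refine eq_univ_of_forall fun x => ?_
    have h := (lp.hasSum_single (E := fun _ : ι => ℂ) (p := 2) (by norm_num) (Ψ.symm x)).mapL
      (Ψ : lp (fun _ : ι => ℂ) 2 →L[ℂ] H)
    simp only [ContinuousLinearEquiv.coe_coe, ContinuousLinearEquiv.apply_symm_apply] at h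
    refine (Submodule.isClosed_topologicalClosure _).mem_of_tendsto h (Eventually.of_forall ?_)
    intro s
    refine Submodule.sum_mem _ fun i _ => Submodule.le_topologicalClosure _ ?_
    have : Ψ (lp.single 2 i (Ψ.symm x i)) = Ψ.symm x i • diagVec Ψ i := by
      rw [diagVec, ← map_smul, ← lp.single_smul, smul_eq_mul, mul_one]
    rw [this]
    exact Submodule.smul_mem _ _ (Submodule.subset_span ⟨e.symm i, by simp⟩)
  · have hid : ∀ z, ‖z‖ ≤ (‖(Ψ.symm : H →L[ℂ] lp (fun _ : ι => ℂ) 2)‖ + 1) * ‖Ψ z‖ := fun z => by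
      have := (Ψ.symm : H →L[ℂ] lp (fun _ : ι => ℂ) 2).le_opNorm (Ψ z)
      simp only [ContinuousLinearEquiv.coe_coe, ContinuousLinearEquiv.symm_apply_apply] at this
      exact this.trans (mul_le_mul_of_nonneg_right (by linarith) (norm_nonneg _))
    have hup : ∀ z, ‖Ψ z‖ ≤ (‖(Ψ : lp (fun _ : ι => ℂ) 2 →L[ℂ] H)‖ + 1) * ‖z‖ := fun z =>
      ((Ψ : lp (fun _ : ι => ℂ) 2 →L[ℂ] H).le_opNorm z).trans
        (mul_le_mul_of_nonneg_right (by linarith) (norm_nonneg _))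
    refine ⟨((‖(Ψ.symm : H →L[ℂ] lp (fun _ : ι => ℂ) 2)‖ + 1) ^ 2)⁻¹,
      (‖(Ψ : lp (fun _ : ι => ℂ) 2 →L[ℂ] H)‖ + 1) ^ 2, by positivity, by positivity, ?_⟩
    intro s c
    have h1 : ∑ n ∈ s, c n • diagVec Ψ (e n)
        = Ψ (∑ i ∈ s.map e.toEmbedding, c (e.symm i) • lp.single 2 i (1 : ℂ)) := by
      rw [Finset.sum_map, map_sum]
      exact Finset.sum_congr rfl fun n _ => by simp [diagVec]
    have h2 : ∑ n ∈ s, ‖c n‖ ^ 2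
        = ‖∑ i ∈ s.map e.toEmbedding,
          c (e.symm i) • (lp.single 2 i (1 : ℂ) : lp (fun _ : ι => ℂ) 2)‖ ^ 2 := by
      rw [norm_sq_sum_single, Finset.sum_map]
      exact Finset.sum_congr rfl fun n _ => by simp
    rw [h1, h2]
    constructor
    · rw [inv_mul_le_iff₀ (by positivity), ← mul_pow]
      exact pow_le_pow_left₀ (norm_nonneg _) (hid _) 2
    · rw [← mul_pow]
      exact pow_le_pow_left₀ (norm_nonneg _) (hup _) 2

/-- For the discrete topology on the index set, cofinite is cocompact, so divergence in norm says
that `lam` is proper. The point set is then its own closure; being countable, it is totally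
disconnected. -/
lemma isClosed_range_of_tendsto (hlim : Tendsto (fun i => ‖lam i‖) cofinite atTop) :
    IsClosed (range lam) := by
  have : Tendsto lam cofinite (cocompact ℂ) := tendsto_norm_atTop_iff_cobounded.1 hlim |>.mono_right
    (Metric.cobounded_eq_cocompact (α := ℂ)).le
  let _ : TopologicalSpace ι := ⊥
  have hd : DiscreteTopology ι := ⟨rfl⟩
  rw [← cocompact_eq_cofinite ι] at this
  exact (isProperMap_iff_tendsto_cocompact.2 ⟨continuous_of_discreteTopology, this⟩).isClosed_range

theorem IsDiagonal.isRieszSpectral (hA : IsDiagonal A Ψ lam) (e : ℕ ≃ ι)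
    (hinj : Function.Injective lam) (hlim : Tendsto (fun i => ‖lam i‖) cofinite atTop) :
    IsRieszSpectral A := by
  refine ⟨hA.isClosed, fun n => lam (e n), ?_⟩
  have hg := fun n => (LinearPMap.mem_graph_iff A).1 (hA.diagVec_mem_graph (e n))
  choose φ hφ hφ' using hg
  have hr : range (fun n => lam (e n)) = range lam := e.surjective.range_comp lam
  refine ⟨φ, hinj.comp e.injective, fun μ => ?_, fun n => hA.isSimpleEigenvalue hinj _,
    fun n => ?_, ?_, ?_⟩
  · rw [hA.isEigenvalue_iff, e.surjective.exists]
  · rw [hφ', hφ]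
  · simp_rw [hφ]
    exact isRieszBasis_diagVec Ψ e
  · rw [hr, (isClosed_range_of_tendsto hlim).closure_eq, ← hr]
    exact (countable_range _).isTotallyDisconnected

/-! ### The semigroup of a diagonal operator and its Cauchy problem -/

variable (Ψ lam) in
/-- The semigroup generated by a diagonal operator. -/
def diagSemigroup {ω : ℝ} (hω : ∀ i, (lam i).re ≤ ω) : C0Semigroup H where
  op t := (Ψ : lp (fun _ : ι => ℂ) 2 →L[ℂ] H).comp
    ((diagExp lam hω t).comp (Ψ.symm : H →L[ℂ] lp (fun _ : ι => ℂ) 2))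
  op_zero := by
    ext x
    refine Ψ.symm.injective ?_
    ext i
    simp
  op_add s t := by
    ext x
    refine Ψ.symm.injective ?_
    ext i
    simp [add_mul, Complex.exp_add, mul_assoc]
  tendsto_zero x := by
    have h := ((Ψ.continuous.comp (continuous_diagExp lam hω (Ψ.symm x))).tendsto 0)
    have h0 : diagExp lam hω 0 (Ψ.symm x) = Ψ.symm x := by
      ext i
      simp
    simpa [Function.comp_def, h0] using h

lemma diagSemigroup_coord {ω : ℝ} (hω : ∀ i, (lam i).re ≤ ω) (t : ℝ≥0) (x : H) (i : ι) :
    Ψ.symm ((diagSemigroup Ψ lam hω).op t x) i = Complex.exp ((t : ℝ) * lam i) * Ψ.symm x i := by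
  simp [diagSemigroup]

lemma continuous_diagSemigroup {ω : ℝ} (hω : ∀ i, (lam i).re ≤ ω) (x : H) :
    Continuous fun t : ℝ => (diagSemigroup Ψ lam hω).op t.toNNReal x :=
  Ψ.continuous.comp ((continuous_diagExp lam hω (Ψ.symm x)).comp continuous_real_toNNReal)

/-- The orbit of a point of the domain agrees, for `t ≥ 0`, with a primitive on the whole line of
a continuous function. -/
lemma IsDiagonal.exists_primitive [CompleteSpace H] (hA : IsDiagonal A Ψ lam) {ω : ℝ}
    (hω : ∀ i, (lam i).re ≤ ω) {x y : H} (hxy : (x, y) ∈ A.graph) :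
    ∃ F : ℝ → H, (∀ t, HasDerivAt F ((diagSemigroup Ψ lam hω).op t.toNNReal y) t) ∧
      ∀ t, 0 ≤ t → (diagSemigroup Ψ lam hω).op t.toNNReal x = F t := by
  have hc := continuous_diagSemigroup (Ψ := Ψ) hω y
  -- Through `toNNReal` the integrand is continuous on all of `ℝ`, so the primitive has a two-sided
  -- derivative even at 0.
  refine ⟨fun t => x + ∫ s in (0 : ℝ)..t, (diagSemigroup Ψ lam hω).op s.toNNReal y,
    fun t => (intervalIntegral.integral_hasDerivAt_right (hc.intervalIntegrable 0 t)
      hc.aestronglyMeasurable.stronglyMeasurableAtFilter hc.continuousAt).const_add x, fun t ht => ?_⟩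
  have hc' : Continuous fun s : ℝ => diagExp lam hω s.toNNReal (Ψ.symm y) :=
    (continuous_diagExp lam hω (Ψ.symm y)).comp continuous_real_toNNReal
  have h := (Ψ : lp (fun _ : ι => ℂ) 2 →L[ℂ] H).intervalIntegral_comp_comm
    (hc'.intervalIntegrable (μ := volume) 0 t)
  have h2 := diagExp_eq_add_integral lam hω ((hA x y).1 hxy) ht
  change Ψ (diagExp lam hω t.toNNReal (Ψ.symm x)) = _
  rw [h2, map_add, ContinuousLinearEquiv.apply_symm_apply]
  exact congrArg (x + ·) h.symm

lemma diagSemigroup_mem_graph {ω : ℝ} (hA : IsDiagonal A Ψ lam) (hω : ∀ i, (lam i).re ≤ ω)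
    {x y : H} (hxy : (x, y) ∈ A.graph) (t : ℝ≥0) :
    ((diagSemigroup Ψ lam hω).op t x, (diagSemigroup Ψ lam hω).op t y) ∈ A.graph := by
  rw [hA] at hxy ⊢
  intro i
  rw [diagSemigroup_coord, diagSemigroup_coord, hxy]
  ring

/-- On the domain, the quotients are slopes at 0 of the primitive. Conversely, if they converge to
`y`, each coordinate of `y` is the derivative at 0 of a scalar exponential, which is exactly the
graph relation. -/
lemma IsDiagonal.isGenerator [CompleteSpace H] (hA : IsDiagonal A Ψ lam) {ω : ℝ}
    (hω : ∀ i, (lam i).re ≤ ω) : IsGenerator (diagSemigroup Ψ lam hω) A := by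
  have hcoe : Tendsto (fun t : ℝ≥0 => (t : ℝ)) (𝓝[>] 0) (𝓝[>] 0) := by
    refine tendsto_nhdsWithin_iff.2 ⟨?_, ?_⟩
    · exact (NNReal.continuous_coe.tendsto' 0 0 rfl).mono_left nhdsWithin_le_nhds
    · filter_upwards [self_mem_nhdsWithin] with t ht
      exact NNReal.coe_pos.2 ht
  intro x y
  constructor
  · intro hxy
    obtain ⟨F, hF, hFx⟩ := hA.exists_primitive hω hxy
    have h0 : (diagSemigroup Ψ lam hω).op 0 y = y := by
      rw [(diagSemigroup Ψ lam hω).op_zero]; rfl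
    have hF0 : F 0 = x := by
      rw [← hFx 0 le_rfl, Real.toNNReal_zero, (diagSemigroup Ψ lam hω).op_zero]; rfl
    have h := (hF 0).tendsto_slope_zero_right.comp hcoe
    rw [Real.toNNReal_zero, h0] at h
    refine h.congr fun t => ?_
    rw [Function.comp_apply, zero_add, hF0, ← hFx t t.2, Real.toNNReal_coe, ← Complex.ofReal_inv,
      Complex.coe_smul]
  · intro h
    rw [hA]
    intro i
    have h1 := ((continuous_coord Ψ i).tendsto y).comp h
    have hd : HasDerivAt (fun s : ℝ => Complex.exp (s * lam i) * Ψ.symm x i)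
        (lam i * Ψ.symm x i) 0 := by
      have h := ((((hasDerivAt_id (0 : ℝ)).ofReal_comp).mul_const (lam i)).cexp).mul_const
        (Ψ.symm x i)
      simpa using h
    have h2 := hd.tendsto_slope_zero_right.comp hcoe
    refine tendsto_nhds_unique h1 (h2.congr fun t => ?_)
    simp only [Function.comp_apply, map_smul, map_sub, lp.coeFn_smul, lp.coeFn_sub, Pi.smul_apply,
      Pi.sub_apply, diagSemigroup_coord, zero_add]
    rw [← Complex.ofReal_inv, Complex.coe_smul]
    simp

/-- Uniqueness is scalar: the `i`-th coordinate of a solution, multiplied by `exp (-s λᵢ)`, has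
derivative zero. -/
theorem IsDiagonal.isWellPosed [CompleteSpace H] (hA : IsDiagonal A Ψ lam) {ω : ℝ}
    (hω : ∀ i, (lam i).re ≤ ω) : IsWellPosed A := by
  refine ⟨diagSemigroup Ψ lam hω, hA.isGenerator hω, fun x₀ hx₀ => ⟨?_, ?_⟩⟩
  · obtain ⟨y, hy⟩ := LinearPMap.mem_domain_iff.1 hx₀
    obtain ⟨F, hF, hFx⟩ := hA.exists_primitive hω hy
    refine ⟨(continuous_diagSemigroup hω x₀).continuousOn, ?_, fun t ht =>
      ⟨_, diagSemigroup_mem_graph hA hω hy _, ?_⟩⟩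
    · simp only [Real.toNNReal_zero, (diagSemigroup Ψ lam hω).op_zero]
      rfl
    · refine (hF t).congr_of_eventuallyEq ?_
      filter_upwards [Ioi_mem_nhds ht] with s hs
      exact hFx s (le_of_lt hs)
  · rintro x ⟨hc, hx0, hx⟩ t ht
    refine Ψ.symm.injective ?_
    ext i
    rw [diagSemigroup_coord, Real.coe_toNNReal t ht]
    let L : H →L[ℂ] ℂ := (coordCLM i).comp
      (Ψ.symm : H →L[ℂ] lp (fun _ : ι => ℂ) 2)
    let f : ℝ → ℂ := fun s => Complex.exp (-(s * lam i)) * L (x s)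
    have hE : ∀ s : ℝ, HasDerivAt (fun s : ℝ => Complex.exp (-(s * lam i)))
        (-(Complex.exp (-(s * lam i)) * lam i)) s := fun s => by
      have h := (((hasDerivAt_id s).ofReal_comp).mul_const (lam i)).neg.cexp
      simpa using h
    have hf : ∀ s, 0 < s → HasDerivAt f 0 s := fun s hs => by
      obtain ⟨y, hy, hxs⟩ := hx s hs
      have h1 : L y = lam i * L (x s) := (hA _ _).1 hy i
      have h2 := (hE s).mul (((L.restrictScalars ℝ).hasFDerivAt (x := x s)).comp_hasDerivAt s hxs)
      refine h2.congr_deriv ?_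
      rw [ContinuousLinearMap.coe_restrictScalars', Function.comp_apply, h1]
      ring
    have hfc : ContinuousOn f (Ici 0) :=
      (by fun_prop : Continuous fun s : ℝ => Complex.exp (-(s * lam i))).continuousOn.mul
        (L.continuous.comp_continuousOn hc)
    have hconst : f t = f 0 := by
      rcases ht.eq_or_lt with rfl | ht
      · rfl
      -- The equation holds only for positive times: constancy is proved on `[ε, t]`, and continuity
      -- at 0 handles `ε → 0`.
      have h1 : ∀ᶠ ε in 𝓝[>] (0 : ℝ), f ε = f t := by
        filter_upwards [Ioo_mem_nhdsGT ht] with ε hε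
        refine (constant_of_has_deriv_right_zero (a := ε) (b := t) ?_ ?_ t ⟨hε.2.le, le_rfl⟩).symm
        · exact hfc.mono fun s hs => hε.1.le.trans hs.1
        · exact fun s hs => (hf s (hε.1.trans_le hs.1)).hasDerivWithinAt
      have h2 : Tendsto f (𝓝[>] 0) (𝓝 (f 0)) :=
        (hfc 0 self_mem_Ici).mono_left (nhdsWithin_mono 0 Ioi_subset_Ici_self)
      exact tendsto_nhds_unique (tendsto_const_nhds.congr' (h1.mono fun _ h => h.symm)) h2
    have h0 : f 0 = Ψ.symm x₀ i := by
      simp only [f, hx0, Complex.ofReal_zero, zero_mul, neg_zero, Complex.exp_zero, one_mul]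
      rfl
    calc Ψ.symm (x t) i = Complex.exp (t * lam i) * f t := by
          simp only [f]
          rw [← mul_assoc, ← Complex.exp_add, add_neg_cancel, Complex.exp_zero, one_mul]
          rfl
      _ = _ := by rw [hconst, h0]

end Abstract

/-! ### Absolutely continuous functions on `[0,1]` -/

/-- `F` is absolutely continuous on `[0,1]` with density `f`. -/
structure Primitive (F f : ℝ → ℂ) : Prop where
  integrable : IntervalIntegrable f volume 0 1
  eq : ∀ z ∈ Icc (0 : ℝ) 1, F z = F 0 + ∫ s in (0 : ℝ)..z, f s

lemma intervalIntegrable_of_mem {f : ℝ → ℂ} (hf : IntervalIntegrable f volume 0 1) {x y : ℝ}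
    (hx : x ∈ Icc (0 : ℝ) 1) (hy : y ∈ Icc (0 : ℝ) 1) : IntervalIntegrable f volume x y := by
  refine hf.mono_set ?_
  rw [uIcc_of_le zero_le_one]
  exact uIcc_subset_Icc hx hy

/-- Increments are dominated by those of the primitive of `‖f‖`, which reduces the complex case to a
real density. -/
lemma absolutelyContinuous_integral {f : ℝ → ℂ} (hf : IntervalIntegrable f volume 0 1) :
    AbsolutelyContinuousOnInterval (fun z => ∫ s in (0 : ℝ)..z, f s) 0 1 := by
  have hn := hf.norm
  have hG := hn.absolutelyContinuousOnInterval_intervalIntegral (c := 0) (by simp)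
  refine squeeze_zero' (Eventually.of_forall fun _ => Finset.sum_nonneg fun _ _ => dist_nonneg)
    ?_ hG
  refine eventually_inf_principal.2 (Eventually.of_forall fun E hE => ?_)
  refine Finset.sum_le_sum fun i hi => ?_
  obtain ⟨hx, hy⟩ := hE.1 i hi
  rw [uIcc_of_le zero_le_one] at hx hy
  have h0 : (0 : ℝ) ∈ Icc (0 : ℝ) 1 := ⟨le_rfl, zero_le_one⟩
  rw [dist_comm, dist_comm (∫ v in (0 : ℝ)..(E.2 i).1, ‖f v‖), dist_eq_norm, dist_eq_norm,
    intervalIntegral.integral_interval_sub_left (intervalIntegrable_of_mem hf h0 hy)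
      (intervalIntegrable_of_mem hf h0 hx),
    intervalIntegral.integral_interval_sub_left (intervalIntegrable_of_mem hf h0 hy).norm
      (intervalIntegrable_of_mem hf h0 hx).norm]
  exact intervalIntegral.norm_integral_le_abs_integral_norm

namespace Primitive

variable {F f K k : ℝ → ℂ}

lemma of_hasDerivWithinAt (hF : ∀ z ∈ Icc (0 : ℝ) 1, HasDerivWithinAt F (f z) (Icc 0 1) z)
    (hf : ContinuousOn f (Icc 0 1)) : Primitive F f where
  integrable := (by rwa [uIcc_of_le zero_le_one] :
    ContinuousOn f (uIcc 0 1)).intervalIntegrable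
  eq z hz := by
    have hs : Icc 0 z ⊆ Icc (0 : ℝ) 1 := Icc_subset_Icc le_rfl hz.2
    rw [intervalIntegral.integral_eq_sub_of_hasDerivAt_of_le hz.1
      (fun y hy => ((hF y (hs hy)).continuousWithinAt).mono hs)
      (fun y hy => (hF y (hs ⟨hy.1.le, hy.2.le⟩)).hasDerivAt
        (Icc_mem_nhds hy.1 (hy.2.trans_le hz.2)))]
    · ring
    · refine ContinuousOn.intervalIntegrable ?_
      rw [uIcc_of_le hz.1]
      exact hf.mono hs

lemma of_hasDerivAt (hF : ∀ z, HasDerivAt F (f z) z) (hf : Continuous f) : Primitive F f :=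
  of_hasDerivWithinAt (fun z _ => (hF z).hasDerivWithinAt) hf.continuousOn

lemma integral (hf : IntervalIntegrable f volume 0 1) :
    Primitive (fun z => ∫ s in (0 : ℝ)..z, f s) f :=
  ⟨hf, fun z _ => by simp⟩

lemma absolutelyContinuous (_ : Primitive F f) :
    AbsolutelyContinuousOnInterval (fun z => F 0 + ∫ s in (0 : ℝ)..z, f s) 0 1 := by
  have hc : AbsolutelyContinuousOnInterval (fun _ : ℝ => F 0) 0 1 :=
    (LipschitzWith.const (F 0)).lipschitzOnWith.absolutelyContinuousOnInterval
  exact hc.add (absolutelyContinuous_integral ‹Primitive F f›.integrable)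

lemma continuousOn (hF : Primitive F f) : ContinuousOn F (Icc 0 1) := by
  have h := hF.absolutelyContinuous.continuousOn
  rw [uIcc_of_le zero_le_one] at h
  exact h.congr fun z hz => hF.eq z hz

lemma hasDerivWithinAt (hF : Primitive F f) (hf : ContinuousOn f (Icc 0 1)) {z : ℝ}
    (hz : z ∈ Icc (0 : ℝ) 1) : HasDerivWithinAt F (f z) (Icc 0 1) z := by
  have hfz : ContinuousWithinAt f (Icc 0 1) z := hf z hz
  have : Fact (z ∈ Icc (0 : ℝ) 1) := ⟨hz⟩
  have h := (intervalIntegral.integral_hasDerivWithinAt_right (s := Icc 0 1) (t := Icc 0 1)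
    (intervalIntegrable_of_mem hF.integrable ⟨le_rfl, zero_le_one⟩ hz)
    (hf.stronglyMeasurableAtFilter_nhdsWithin measurableSet_Icc z) hfz).const_add (F 0)
  exact h.congr (fun y hy => hF.eq y hy) (hF.eq z hz)

lemma add (hF : Primitive F f) (hK : Primitive K k) :
    Primitive (fun z => F z + K z) (fun z => f z + k z) where
  integrable := hF.integrable.add hK.integrable
  eq z hz := by
    have h0 : (0 : ℝ) ∈ Icc (0 : ℝ) 1 := ⟨le_rfl, zero_le_one⟩
    rw [intervalIntegral.integral_add (intervalIntegrable_of_mem hF.integrable h0 hz)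
      (intervalIntegrable_of_mem hK.integrable h0 hz), hF.eq z hz, hK.eq z hz]
    ring

lemma const_mul (hF : Primitive F f) (c : ℂ) :
    Primitive (fun z => c * F z) (fun z => c * f z) where
  integrable := hF.integrable.const_mul c
  eq z hz := by
    rw [intervalIntegral.integral_const_mul, hF.eq z hz]
    ring

lemma sub (hF : Primitive F f) (hK : Primitive K k) :
    Primitive (fun z => F z - K z) (fun z => f z - k z) := by
  have h := hF.add (hK.const_mul (-1))
  simpa only [neg_one_mul, ← sub_eq_add_neg] using h

lemma congr_density (hF : Primitive F f)
    (h : ∀ᵐ z ∂(volume.restrict (Ioo (0 : ℝ) 1)), f z = k z) : Primitive F k := by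
  have h' : ∀ z ∈ Icc (0 : ℝ) 1, ∀ᵐ s ∂(volume.restrict (uIoc 0 z)), f s = k s := fun z hz => by
    rw [uIoc_of_le hz.1, ← restrict_Ioo_eq_restrict_Ioc]
    exact ae_restrict_of_ae_restrict_of_subset (Ioo_subset_Ioo le_rfl hz.2) h
  exact ⟨hF.integrable.congr_ae (h' 1 ⟨zero_le_one, le_rfl⟩), fun z hz => by
    rw [hF.eq z hz, intervalIntegral.integral_congr_ae_restrict (h' z hz)]⟩

lemma conj (hF : Primitive F f) :
    Primitive (fun z => (starRingEnd ℂ) (F z)) (fun z => (starRingEnd ℂ) (f z)) where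
  integrable := by
    have h := hF.integrable
    rw [intervalIntegrable_iff] at h ⊢
    exact (Complex.conjCLE : ℂ →L[ℝ] ℂ).integrable_comp h
  eq z hz := by
    have h := (Complex.conjCLE : ℂ →L[ℝ] ℂ).intervalIntegral_comp_comm
      (intervalIntegrable_of_mem hF.integrable ⟨le_rfl, zero_le_one⟩ hz)
    simp only [ContinuousLinearEquiv.coe_coe, Complex.conjCLE_apply] at h
    rw [hF.eq z hz, map_add, h]

/-- The product rule for absolutely continuous functions. -/
lemma mul (hF : Primitive F f) (hK : Primitive K k) :
    Primitive (fun z => F z * K z) (fun z => f z * K z + F z * k z) := by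
  have hFc := hF.continuousOn
  have hKc := hK.continuousOn
  have hI : uIcc (0 : ℝ) 1 = Icc 0 1 := uIcc_of_le zero_le_one
  have hint : IntervalIntegrable (fun z => f z * K z + F z * k z) volume 0 1 :=
    (hF.integrable.mul_continuousOn (by rwa [hI])).add
      (hK.integrable.continuousOn_mul (by rwa [hI]))
  refine ⟨hint, fun z hz => ?_⟩
  set F' : ℝ → ℂ := fun z => F 0 + ∫ s in (0 : ℝ)..z, f s
  set K' : ℝ → ℂ := fun z => K 0 + ∫ s in (0 : ℝ)..z, k s
  -- The product minus the candidate integral is absolutely continuous with derivative zero almost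
  -- everywhere, hence constant. `F'` and `K'` are the integral formulas that agree with `F` and `K`
  -- on `[0,1]`.
  have hAC := (hF.absolutelyContinuous.smul hK.absolutelyContinuous).sub
    (absolutelyContinuous_integral hint)
  have hd : ∀ᵐ x : ℝ, x ∈ uIcc (0 : ℝ) 1 → HasDerivAt
      (F' • K' - fun z => ∫ s in (0 : ℝ)..z, (f s * K s + F s * k s)) 0 x := by
    filter_upwards [hF.integrable.ae_hasDerivAt_integral, hK.integrable.ae_hasDerivAt_integral,
      hint.ae_hasDerivAt_integral] with x h1 h2 h3 hx
    have h0 : (0 : ℝ) ∈ uIcc (0 : ℝ) 1 := by simp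
    have := (((h1 hx 0 h0).const_add (F 0)).mul ((h2 hx 0 h0).const_add (K 0))).sub (h3 hx 0 h0)
    refine this.congr_deriv ?_
    rw [hI] at hx
    rw [hF.eq x hx, hK.eq x hx]
    ring
  obtain ⟨C, hC⟩ := hAC.const_of_ae_hasDerivAt_zero hd
  rw [hI] at hC
  have e0 := hC 0 ⟨le_rfl, zero_le_one⟩
  have ez := hC z hz
  simp only [Pi.sub_apply, Pi.mul_apply, intervalIntegral.integral_same, add_zero, sub_zero,
    smul_eq_mul] at e0 ez
  rw [hF.eq z hz, hK.eq z hz, e0, ← ez]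
  ring

lemma eq_of_density_zero (hF : Primitive F f)
    (h : ∀ᵐ z ∂(volume.restrict (Ioo (0 : ℝ) 1)), f z = 0) {z : ℝ} (hz : z ∈ Icc (0 : ℝ) 1) :
    F z = F 0 := by
  have := (hF.congr_density (k := fun _ => 0) h).eq z hz
  simpa using this

end Primitive

lemma hasDerivAt_cexp_mul (c : ℂ) (z : ℝ) :
    HasDerivAt (fun z : ℝ => Complex.exp (c * z)) (c * Complex.exp (c * z)) z := by
  have h := (((hasDerivAt_id z).ofReal_comp).const_mul c).cexp
  simp only [id, Complex.ofReal_one, mul_one] at h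
  rwa [mul_comm] at h

lemma primitive_cexp_mul (c : ℂ) :
    Primitive (fun z : ℝ => Complex.exp (c * z)) (fun z => c * Complex.exp (c * z)) :=
  Primitive.of_hasDerivAt (hasDerivAt_cexp_mul c) (by fun_prop)

/-- An absolutely continuous solution of `F' = c F` is an exponential function. -/
lemma Primitive.eq_cexp {F f : ℝ → ℂ} (hF : Primitive F f) (c : ℂ)
    (h : ∀ᵐ z ∂(volume.restrict (Ioo (0 : ℝ) 1)), f z = c * F z) {z : ℝ}
    (hz : z ∈ Icc (0 : ℝ) 1) : F z = F 0 * Complex.exp (c * z) := by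
  have h1 := ((primitive_cexp_mul (-c)).mul hF).eq_of_density_zero
    (by filter_upwards [h] with x hx; rw [hx]; ring) hz
  simp only [Complex.ofReal_zero, mul_zero, Complex.exp_zero, one_mul, neg_mul] at h1
  rw [← h1, mul_right_comm, ← Complex.exp_add, neg_add_cancel, Complex.exp_zero, one_mul]

/-! ### The second derivative with Robin boundary conditions -/

lemma zero_mem_Icc01 : (0 : ℝ) ∈ Icc (0 : ℝ) 1 := ⟨le_rfl, zero_le_one⟩

lemma one_mem_Icc01 : (1 : ℝ) ∈ Icc (0 : ℝ) 1 := ⟨zero_le_one, le_rfl⟩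

lemma memLp_of_continuousOn {u : ℝ → ℂ} (hu : ContinuousOn u (Icc 0 1)) :
    MemLp u 2 (volume.restrict (Ioo (0 : ℝ) 1)) := by
  obtain ⟨C, hC⟩ := isCompact_Icc.exists_bound_of_continuousOn hu
  refine MemLp.of_bound
    ((hu.mono Ioo_subset_Icc_self).aestronglyMeasurable measurableSet_Ioo) C ?_
  exact (ae_restrict_iff' measurableSet_Ioo).2
    (Eventually.of_forall fun z hz => hC z (Ioo_subset_Icc_self hz))

lemma exists_L2_of_continuousOn {u : ℝ → ℂ} (hu : ContinuousOn u (Icc 0 1)) :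
    ∃ h : L2, ∀ᵐ z ∂(volume.restrict (Ioo (0 : ℝ) 1)), h z = u z :=
  ⟨(memLp_of_continuousOn hu).toLp u, MemLp.coeFn_toLp _⟩

lemma L2.norm_le_of_bound {h : L2} {u : ℝ → ℂ} {C : ℝ} (hC : 0 ≤ C)
    (hu : ∀ᵐ z ∂(volume.restrict (Ioo (0 : ℝ) 1)), h z = u z)
    (hb : ∀ z ∈ Icc (0 : ℝ) 1, ‖u z‖ ≤ C) : ‖h‖ ≤ C := by
  have h1 : ∀ᵐ z ∂(volume.restrict (Ioo (0 : ℝ) 1)), ‖h z‖ ≤ C := by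
    filter_upwards [hu, ae_restrict_mem measurableSet_Ioo] with z hz hz01
    rw [hz]
    exact hb z (Ioo_subset_Icc_self hz01)
  have h2 : measureUnivNNReal (volume.restrict (Ioo (0 : ℝ) 1)) = 1 := by
    simp [measureUnivNNReal]
  simpa [h2] using Lp.norm_le_of_ae_bound hC h1

lemma L2.integral_norm_le (f : L2) : ∫ s in (0 : ℝ)..1, ‖f s‖ ≤ ‖f‖ := by
  have : IsProbabilityMeasure (volume.restrict (Ioo (0 : ℝ) 1)) := ⟨by simp⟩
  rw [intervalIntegral.integral_of_le zero_le_one, ← restrict_Ioo_eq_restrict_Ioc,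
    integral_norm_eq_lintegral_enorm (Lp.aestronglyMeasurable f), Lp.norm_def,
    ← eLpNorm_one_eq_lintegral_enorm]
  exact ENNReal.toReal_mono (Lp.eLpNorm_ne_top f)
    (eLpNorm_le_eLpNorm_of_exponent_le (by norm_num) (Lp.aestronglyMeasurable f))

namespace IsH2

variable {h w : L2} {u v : ℝ → ℂ}

lemma primitive_snd (H : IsH2 h w u v) : Primitive v w :=
  ⟨L2.intervalIntegrable w, H.snd_deriv⟩

lemma primitive_fst (H : IsH2 h w u v) : Primitive u v :=
  Primitive.of_hasDerivWithinAt H.fst_deriv H.primitive_snd.continuousOn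

lemma of_primitive (hae : ∀ᵐ z ∂(volume.restrict (Ioo (0 : ℝ) 1)), h z = u z)
    (hu : Primitive u v) (hv : Primitive v w) : IsH2 h w u v :=
  ⟨hae, fun _ hz => hu.hasDerivWithinAt hv.continuousOn hz, hv.eq⟩

lemma eq_zero_of_eqOn (H : IsH2 h w u v) (hu : ∀ z ∈ Icc (0 : ℝ) 1, u z = 0) : h = 0 := by
  refine (Lp.eq_zero_iff_ae_eq_zero).2 ?_
  filter_upwards [H.ae_eq, ae_restrict_mem measurableSet_Ioo] with z hz hz01
  rw [hz, hu z (Ioo_subset_Icc_self hz01)]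
  rfl

/-- Factorisation of `u'' = κ² u` into first order equations. -/
lemma snd_add_mul_fst {κ : ℂ} (H : IsH2 h (κ ^ 2 • h) u v) {z : ℝ} (hz : z ∈ Icc (0 : ℝ) 1) :
    v z + κ * u z = (v 0 + κ * u 0) * Complex.exp (κ * z) := by
  refine (H.primitive_snd.add (H.primitive_fst.const_mul κ)).eq_cexp κ ?_ hz
  filter_upwards [H.ae_eq, Lp.coeFn_smul (κ ^ 2) h] with s h1 h2
  rw [h2, Pi.smul_apply, h1, smul_eq_mul]
  ring

/-- Both factorisations, with `κ` and with `-κ`, have vanishing right-hand side. Adding them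
eliminates `u` and gives `v = 0` without dividing by `κ`, so `θ = 0` is not a separate case. -/
lemma eq_zero_of_initial {θ : ℂ} (H : IsH2 h (θ • h) u v) (hu : u 0 = 0) (hv : v 0 = 0) :
    h = 0 := by
  obtain ⟨κ, hκ⟩ := IsAlgClosed.exists_pow_nat_eq θ two_pos
  have H1 : IsH2 h (κ ^ 2 • h) u v := by rwa [hκ]
  have H2 : IsH2 h ((-κ) ^ 2 • h) u v := by rwa [neg_sq, hκ]
  have hv0 : ∀ z ∈ Icc (0 : ℝ) 1, v z = 0 := fun z hz => by
    have h1 := H1.snd_add_mul_fst hz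
    have h2 := H2.snd_add_mul_fst hz
    rw [hu, hv, mul_zero, add_zero, zero_mul] at h1 h2
    linear_combination (h1 + h2) / 2
  refine H.eq_zero_of_eqOn fun z hz => ?_
  rw [← hu]
  refine H.primitive_fst.eq_of_density_zero ?_ hz
  filter_upwards [ae_restrict_mem measurableSet_Ioo] with s hs
  exact hv0 s (Ioo_subset_Icc_self hs)

end IsH2

/-- `h ∈ H²(0,1)` satisfies homogeneous Robin boundary conditions and `h'' = w`. -/
def SLRel (q₀ q₁ : ℝ) (h w : L2) : Prop :=
  ∃ u v : ℝ → ℂ, IsH2 h w u v ∧ v 0 = q₀ * u 0 ∧ v 1 = q₁ * u 1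

namespace SLRel

variable {q₀ q₁ : ℝ} {h w h' w' : L2}

lemma add (H : SLRel q₀ q₁ h w) (H' : SLRel q₀ q₁ h' w') : SLRel q₀ q₁ (h + h') (w + w') := by
  obtain ⟨u, v, H, h0, h1⟩ := H
  obtain ⟨u', v', H', h0', h1'⟩ := H'
  exact ⟨_, _, H.add H', by rw [h0, h0']; ring, by rw [h1, h1']; ring⟩

lemma smul (c : ℂ) (H : SLRel q₀ q₁ h w) : SLRel q₀ q₁ (c • h) (c • w) := by
  obtain ⟨u, v, H, h0, h1⟩ := H
  exact ⟨_, _, H.smul c, by rw [h0]; ring, by rw [h1]; ring⟩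

lemma sub (H : SLRel q₀ q₁ h w) (H' : SLRel q₀ q₁ h' w') : SLRel q₀ q₁ (h - h') (w - w') := by
  have := H.add (H'.smul (-1))
  simpa only [neg_smul, one_smul, ← sub_eq_add_neg] using this

/-- Green's formula. -/
lemma inner_comm (H : SLRel q₀ q₁ h w) (H' : SLRel q₀ q₁ h' w') :
    inner ℂ w h' = inner ℂ h w' := by
  obtain ⟨u, v, H, h0, h1⟩ := H
  obtain ⟨u', v', H', h0', h1'⟩ := H'
  have hP := (H.primitive_snd.conj.mul H'.primitive_fst).sub
    (H.primitive_fst.conj.mul H'.primitive_snd)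
  have hd := hP.congr_density
    (k := fun z => inner ℂ (w z) (h' z) - inner ℂ (h z) (w' z)) (by
      filter_upwards [H.ae_eq, H'.ae_eq] with z e e'
      rw [RCLike.inner_apply, RCLike.inner_apply, e, e']
      ring)
  have h01 := hd.eq 1 one_mem_Icc01
  -- Because `q₀` and `q₁` are real, the boundary terms cancel at each endpoint.
  rw [h0, h1, h0', h1', map_mul, map_mul, Complex.conj_ofReal, Complex.conj_ofReal,
    intervalIntegral.integral_of_le zero_le_one, ← restrict_Ioo_eq_restrict_Ioc,
    integral_sub (L2.integrable_inner w h') (L2.integrable_inner h w'), ← L2.inner_def,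
    ← L2.inner_def] at h01
  linear_combination -h01

/-- The condition at 0 makes `u 0` determine all initial data, so a combination of two
eigenfunctions that vanishes at 0 is zero. -/
lemma eq_smul_of_eigen {θ : ℂ} (H : SLRel q₀ q₁ h (θ • h)) (hne : h ≠ 0)
    (H' : SLRel q₀ q₁ h' (θ • h')) : ∃ c : ℂ, h' = c • h := by
  obtain ⟨u, v, H, h0, h1⟩ := H
  obtain ⟨u', v', H', h0', h1'⟩ := H'
  have hu : u 0 ≠ 0 := fun hu => hne (H.eq_zero_of_initial hu (by rw [h0, hu, mul_zero]))
  refine ⟨u' 0 / u 0, ?_⟩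
  have HH := H'.add (H.smul (-(u' 0 / u 0)))
  have e : θ • h' + -(u' 0 / u 0) • θ • h = θ • (h' + -(u' 0 / u 0) • h) := by
    rw [smul_add, smul_comm]
  rw [e] at HH
  have := HH.eq_zero_of_initial (by field_simp; ring) (by rw [h0, h0']; field_simp; ring)
  rw [neg_smul, ← sub_eq_add_neg] at this
  exact sub_eq_zero.1 this

end SLRel

/-- The characteristic function of the Robin problem for `u'' = κ² u`. -/
def robinDet (q₀ q₁ κ : ℝ) : ℝ :=
  (κ + q₀) * (κ - q₁) * Real.exp κ - (κ - q₀) * (κ + q₁) * Real.exp (-κ)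

/-- The terms `3 * |qᵢ|` in the threshold bound the second polynomial factor by four times the
first; the summand 2 ensures `exp κ ≥ 3`, hence `4 * exp (-κ) < exp κ`. -/
lemma robinDet_pos (q₀ q₁ : ℝ) {κ : ℝ} (hκ : 2 + 3 * |q₀| + 3 * |q₁| ≤ κ) :
    0 < robinDet q₀ q₁ κ := by
  have a1 := abs_nonneg q₀
  have a2 := abs_nonneg q₁
  have b1 := le_abs_self q₀
  have b2 := le_abs_self q₁
  have c1 := neg_abs_le q₀
  have c2 := neg_abs_le q₁
  have h1 : (κ - q₀) ≤ 2 * (κ + q₀) := by linarith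
  have h2 : (κ + q₁) ≤ 2 * (κ - q₁) := by linarith
  have h3 : (κ - q₀) * (κ + q₁) ≤ 2 * (κ + q₀) * (2 * (κ - q₁)) :=
    mul_le_mul h1 h2 (by linarith) (by linarith)
  have h4 : 0 < (κ + q₀) * (κ - q₁) := mul_pos (by linarith) (by linarith)
  have h5 : 4 * Real.exp (-κ) < Real.exp κ := by
    have e1 : Real.exp (-κ) ≤ 1 / 3 := by
      rw [Real.exp_neg, inv_eq_one_div]
      exact one_div_le_one_div_of_le (by norm_num) (by linarith [Real.add_one_le_exp κ])
    linarith [Real.add_one_le_exp κ]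
  have h6 : (κ - q₀) * (κ + q₁) * Real.exp (-κ)
      ≤ 2 * (κ + q₀) * (2 * (κ - q₁)) * Real.exp (-κ) :=
    mul_le_mul_of_nonneg_right h3 (Real.exp_pos _).le
  have h7 := mul_lt_mul_of_pos_left h5 h4
  rw [robinDet]
  linarith

/-- If the characteristic function does not vanish, then `κ²` is not an eigenvalue. -/
lemma SLRel.eq_zero_of_robinDet {q₀ q₁ κ : ℝ} {h : L2}
    (hd : robinDet q₀ q₁ κ ≠ 0) (H : SLRel q₀ q₁ h (((κ : ℂ) ^ 2) • h)) : h = 0 := by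
  obtain ⟨u, v, H, h0, h1⟩ := H
  have H2 : IsH2 h ((-(κ : ℂ)) ^ 2 • h) u v := by rwa [neg_sq]
  have e1 := H.snd_add_mul_fst one_mem_Icc01
  have e2 := H2.snd_add_mul_fst one_mem_Icc01
  rw [h0, h1, Complex.ofReal_one, mul_one] at e1 e2
  -- This combination eliminates `u 1` from the two first-order identities at the right endpoint.
  have e3 : (robinDet q₀ q₁ κ : ℂ) * u 0 = 0 := by
    rw [robinDet]
    push_cast
    linear_combination (-(κ : ℂ) + q₁) * e1 - ((κ : ℂ) + q₁) * e2
  have hu : u 0 = 0 := (mul_eq_zero.1 e3).resolve_left (by exact_mod_cast hd)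
  exact H.eq_zero_of_initial hu (by rw [h0, hu, mul_zero])

/-- Solution of `E' = c E + f`, `E(0) = 0`. -/
lemma exists_first_order (c : ℝ) : ∃ C, 0 ≤ C ∧ ∀ f : L2, ∃ E : ℝ → ℂ,
    Primitive E (fun z => c * E z + f z) ∧ E 0 = 0 ∧
      ∀ z ∈ Icc (0 : ℝ) 1, ‖E z‖ ≤ C * ‖f‖ := by
  -- Variation of constants: one factor for `exp (c z)` outside the integral, one for `exp (-c s)`
  -- inside.
  refine ⟨Real.exp |c| * Real.exp |c|, by positivity, fun f => ?_⟩
  have hb : ∀ d : ℝ, |d| = |c| → ∀ z ∈ Icc (0 : ℝ) 1, ‖Complex.exp (d * z)‖ ≤ Real.exp |c| := by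
    intro d hd z hz
    rw [Complex.norm_exp, ← Complex.ofReal_mul, Complex.ofReal_re, ← hd]
    refine Real.exp_le_exp.2 ?_
    calc d * z ≤ |d| * z := mul_le_mul_of_nonneg_right (le_abs_self d) hz.1
      _ ≤ |d| := mul_le_of_le_one_right (abs_nonneg d) hz.2
  have hint : IntervalIntegrable (fun s : ℝ => Complex.exp ((-c : ℝ) * s) * f s) volume 0 1 :=
    (L2.intervalIntegrable f).continuousOn_mul
      (by fun_prop : Continuous fun s : ℝ => Complex.exp ((-c : ℝ) * s)).continuousOn
  refine ⟨fun z => Complex.exp (c * z) * ∫ s in (0 : ℝ)..z, Complex.exp ((-c : ℝ) * s) * f s,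
    ?_, by simp, fun z hz => ?_⟩
  · refine ((primitive_cexp_mul c).mul (Primitive.integral hint)).congr_density
      (Eventually.of_forall fun z => ?_)
    simp only
    rw [← mul_assoc (Complex.exp (c * z)) (Complex.exp _), ← Complex.exp_add]
    push_cast
    rw [neg_mul, add_neg_cancel, Complex.exp_zero]
    ring
  · rw [norm_mul, mul_assoc]
    refine mul_le_mul (hb c rfl z hz) ?_ (norm_nonneg _) (Real.exp_pos _).le
    calc ‖∫ s in (0 : ℝ)..z, Complex.exp ((-c : ℝ) * s) * f s‖
        ≤ ∫ s in (0 : ℝ)..z, ‖Complex.exp ((-c : ℝ) * s) * f s‖ :=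
          intervalIntegral.norm_integral_le_integral_norm hz.1
      _ ≤ ∫ s in (0 : ℝ)..1, ‖Complex.exp ((-c : ℝ) * s) * f s‖ :=
          intervalIntegral.integral_mono_interval le_rfl hz.1 hz.2
            (Eventually.of_forall fun _ => norm_nonneg _) hint.norm
      _ ≤ ∫ s in (0 : ℝ)..1, Real.exp |c| * ‖f s‖ := by
          refine intervalIntegral.integral_mono_on zero_le_one hint.norm
            ((L2.intervalIntegrable f).norm.const_mul _) fun s hs => ?_
          rw [norm_mul]
          exact mul_le_mul_of_nonneg_right (hb (-c) (abs_neg c) s hs) (norm_nonneg _)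
      _ ≤ Real.exp |c| * ‖f‖ := by
          rw [intervalIntegral.integral_const_mul]
          exact mul_le_mul_of_nonneg_left (L2.integral_norm_le f) (Real.exp_pos _).le

/-- Solvability of `u'' = κ² u + f` with Robin boundary conditions. -/
lemma exists_solution {q₀ q₁ κ : ℝ} (hκ : κ ≠ 0) (hd : robinDet q₀ q₁ κ ≠ 0) :
    ∃ C, 0 ≤ C ∧ ∀ f : L2, ∃ (h : L2) (u v : ℝ → ℂ),
      IsH2 h (((κ : ℂ) ^ 2) • h + f) u v ∧ v 0 = q₀ * u 0 ∧ v 1 = q₁ * u 1 ∧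
        ∀ z ∈ Icc (0 : ℝ) 1, ‖u z‖ ≤ C * ‖f‖ ∧ ‖v z‖ ≤ C * ‖f‖ := by
  obtain ⟨C₁, hC₁, h₁⟩ := exists_first_order κ
  obtain ⟨C₂, hC₂, h₂⟩ := exists_first_order (-κ)
  have hκ' : (κ : ℂ) ≠ 0 := by exact_mod_cast hκ
  have hd' : (robinDet q₀ q₁ κ : ℂ) ≠ 0 := by exact_mod_cast hd
  -- A homogeneous solution satisfying the left boundary condition; its defect in the right one is
  -- exactly `robinDet`.
  set y : ℝ → ℂ := fun z => (κ + q₀) * Complex.exp (κ * z) + (κ - q₀) * Complex.exp (-κ * z)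
    with hy
  set y' : ℝ → ℂ := fun z =>
    κ * ((κ + q₀) * Complex.exp (κ * z) - (κ - q₀) * Complex.exp (-κ * z)) with hy'
  have hyP : Primitive y y' := by
    refine (((primitive_cexp_mul κ).const_mul (κ + q₀)).add
      ((primitive_cexp_mul (-κ)).const_mul (κ - q₀))).congr_density
      (Eventually.of_forall fun z => ?_)
    simp only [hy']
    ring
  have hyP' : Primitive y' (fun z => κ ^ 2 * y z) := by
    refine ((((primitive_cexp_mul κ).const_mul (κ + q₀)).sub
      ((primitive_cexp_mul (-κ)).const_mul (κ - q₀))).const_mul κ).congr_density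
      (Eventually.of_forall fun z => ?_)
    simp only [hy]
    ring
  have hdet : y' 1 - q₁ * y 1 = robinDet q₀ q₁ κ := by
    simp only [hy, hy', robinDet]
    push_cast
    rw [mul_one, mul_one]
    ring
  have hy0 : y' 0 = q₀ * y 0 := by
    simp only [hy, hy']
    push_cast
    rw [mul_zero, mul_zero, Complex.exp_zero]
    ring
  obtain ⟨B, hB⟩ := isCompact_Icc.exists_bound_of_continuousOn hyP.continuousOn
  obtain ⟨B', hB'⟩ := isCompact_Icc.exists_bound_of_continuousOn hyP'.continuousOn
  have hB0 : 0 ≤ B := (norm_nonneg _).trans (hB 0 zero_mem_Icc01)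
  have hB0' : 0 ≤ B' := (norm_nonneg _).trans (hB' 0 zero_mem_Icc01)
  set D : ℝ := ‖(2 * κ : ℂ)⁻¹‖ * (C₁ + C₂) with hD
  set D' : ℝ := ‖(2 : ℂ)⁻¹‖ * (C₁ + C₂) with hD'
  set α : ℝ := ‖(robinDet q₀ q₁ κ : ℂ)⁻¹‖ * (D' + ‖(q₁ : ℂ)‖ * D) with hα
  have hD0 : 0 ≤ D := by positivity
  have hD0' : 0 ≤ D' := by positivity
  have hα0 : 0 ≤ α := by positivity
  refine ⟨max (D + α * B) (D' + α * B'), le_max_of_le_left (by positivity), fun f => ?_⟩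
  obtain ⟨E₁, hE₁, hE₁0, hE₁b⟩ := h₁ f
  obtain ⟨E₂, hE₂, hE₂0, hE₂b⟩ := h₂ f
  -- A particular solution with zero initial data, from `E₁' = κ E₁ + f` and `E₂' = -κ E₂ + f`; `p'`
  -- is its derivative.
  set p : ℝ → ℂ := fun z => (2 * κ : ℂ)⁻¹ * (E₁ z - E₂ z) with hp
  set p' : ℝ → ℂ := fun z => (2 : ℂ)⁻¹ * (E₁ z + E₂ z) with hp'
  have hpP : Primitive p p' := by
    refine ((hE₁.sub hE₂).const_mul (2 * κ : ℂ)⁻¹).congr_density (Eventually.of_forall fun z => ?_)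
    simp only [hp']
    push_cast
    field_simp
    ring
  have hpP' : Primitive p' (fun z => κ ^ 2 * p z + f z) := by
    refine ((hE₁.add hE₂).const_mul (2 : ℂ)⁻¹).congr_density (Eventually.of_forall fun z => ?_)
    simp only [hp]
    push_cast
    field_simp
    ring
  -- The multiple of `y` that repairs the right boundary condition; the left one is unaffected.
  set c : ℂ := -((robinDet q₀ q₁ κ : ℂ)⁻¹ * (p' 1 - q₁ * p 1)) with hc
  have hu := hpP.add (hyP.const_mul c)
  have hv := hpP'.add (hyP'.const_mul c)
  obtain ⟨h, hh⟩ := exists_L2_of_continuousOn hu.continuousOn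
  have hpb : ∀ z ∈ Icc (0 : ℝ) 1, ‖p z‖ ≤ D * ‖f‖ := fun z hz => by
    rw [hp, norm_mul, hD, mul_assoc]
    refine mul_le_mul_of_nonneg_left ((norm_sub_le _ _).trans ?_) (norm_nonneg _)
    linarith [hE₁b z hz, hE₂b z hz]
  have hpb' : ∀ z ∈ Icc (0 : ℝ) 1, ‖p' z‖ ≤ D' * ‖f‖ := fun z hz => by
    rw [hp', norm_mul, hD', mul_assoc]
    refine mul_le_mul_of_nonneg_left ((norm_add_le _ _).trans ?_) (norm_nonneg _)
    linarith [hE₁b z hz, hE₂b z hz]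
  have hcb : ‖c‖ ≤ α * ‖f‖ := by
    rw [hc, norm_neg, norm_mul, hα, mul_assoc]
    refine mul_le_mul_of_nonneg_left ((norm_sub_le _ _).trans ?_) (norm_nonneg _)
    rw [norm_mul (q₁ : ℂ), add_mul, mul_assoc ‖(q₁ : ℂ)‖]
    exact add_le_add (hpb' 1 one_mem_Icc01)
      (mul_le_mul_of_nonneg_left (hpb 1 one_mem_Icc01) (norm_nonneg _))
  refine ⟨h, _, _, IsH2.of_primitive hh hu (hv.congr_density ?_), ?_, ?_, fun z hz => ⟨?_, ?_⟩⟩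
  · filter_upwards [hh, Lp.coeFn_add (((κ : ℂ) ^ 2) • h) f, Lp.coeFn_smul ((κ : ℂ) ^ 2) h]
      with z e1 e2 e3
    rw [e2, Pi.add_apply, e3, Pi.smul_apply, e1, smul_eq_mul]
    ring
  · have hp0 : p 0 = 0 := by simp only [hp, hE₁0, hE₂0]; ring
    have hp0' : p' 0 = 0 := by simp only [hp', hE₁0, hE₂0]; ring
    rw [hp0, hp0', hy0]
    ring
  · have : c * (y' 1 - q₁ * y 1) = -(p' 1 - q₁ * p 1) := by
      rw [hdet, hc]
      field_simp
    linear_combination this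
  · refine (norm_add_le _ _).trans (le_trans ?_
      (mul_le_mul_of_nonneg_right (le_max_left _ _) (norm_nonneg f)))
    rw [norm_mul c]
    have := mul_le_mul hcb (hB z hz) (norm_nonneg _) (by positivity)
    linarith [hpb z hz]
  · refine (norm_add_le _ _).trans (le_trans ?_
      (mul_le_mul_of_nonneg_right (le_max_right _ _) (norm_nonneg f)))
    rw [norm_mul c]
    have := mul_le_mul hcb (hB' z hz) (norm_nonneg _) (by positivity)
    linarith [hpb' z hz]

/-! ### Eigenbases of compact symmetric operators with simple eigenvalues -/

section Compact

variable {H : Type*} [NormedAddCommGroup H] [InnerProductSpace ℂ H]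

/-- Eigenvalues of a compact operator belonging to orthonormal eigenvectors tend to zero. -/
lemma tendsto_eigenvalue_zero {G : H →L[ℂ] H} (hG : IsCompactOperator G) {Λ : Type*}
    {v : Λ → H} (hv : Orthonormal ℂ v) {γ : Λ → ℂ} (hγ : ∀ i, G (v i) = γ i • v i) :
    Tendsto γ cofinite (𝓝 0) := by
  refine Metric.tendsto_nhds.2 fun ε hε => ?_
  rw [eventually_cofinite]
  by_contra hinf
  have hinf : {i | ¬ dist (γ i) 0 < ε}.Infinite := hinf
  obtain ⟨K, hK, hKs⟩ := hG.image_closedBall_subset_compact (f := (G : H →ₗ[ℂ] H)) 1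
  let s := hinf.natEmbedding
  have hmem : ∀ n, G (v (s n)) ∈ K := fun n =>
    hKs ⟨v (s n), by simp [hv.1], rfl⟩
  obtain ⟨x, -, φ, hφ, hlim⟩ := hK.tendsto_subseq hmem
  obtain ⟨N, hN⟩ := Metric.cauchySeq_iff'.1 hlim.cauchySeq ε hε
  have h1 := hN (N + 1) (Nat.le_succ N)
  have hne : ((s (φ (N + 1)) : {i | ¬ dist (γ i) 0 < ε}) : Λ) ≠ s (φ N) := fun h =>
    (hφ (Nat.lt_succ_self N)).ne' (s.injective (Subtype.ext h))
  have hge := (s (φ (N + 1))).2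
  simp only [mem_ofPred_eq, dist_zero_right, not_lt] at hge
  rw [Function.comp_apply, Function.comp_apply, hγ, hγ, dist_eq_norm] at h1
  -- Pairing the difference with one of its two orthonormal vectors isolates a single eigenvalue, of
  -- modulus at least `ε`, although the difference has norm below `ε`.
  have h2 : ‖inner ℂ (v (s (φ (N + 1))))
      (γ (s (φ (N + 1))) • v (s (φ (N + 1))) - γ (s (φ N)) • v (s (φ N)))‖
        ≤ ‖v (s (φ (N + 1)))‖ * _ := norm_inner_le_norm _ _
  rw [inner_sub_right, inner_smul_right, inner_smul_right, hv.2 hne, mul_zero, sub_zero,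
    inner_self_eq_norm_sq_to_K, hv.1] at h2
  norm_num at h2
  linarith

/-- Indexing by the eigenvalues themselves makes them distinct, and one unit vector per eigenvalue
is enough because eigenspaces are lines. The spectral theorem gives completeness. Injectivity
excludes the eigenvalue 0, so convergence to 0 makes the index set countable; infinite dimension
makes it infinite. -/
lemma exists_eigenbasis [CompleteSpace H] (hH : ¬ FiniteDimensional ℂ H) {G : H →L[ℂ] H}
    (hG : IsCompactOperator G) (hsym : (G : H →ₗ[ℂ] H).IsSymmetric)
    (hinj : Function.Injective G)
    (hsimple : ∀ (μ : ℂ) (x y : H), G x = μ • x → x ≠ 0 → G y = μ • y → ∃ c : ℂ, y = c • x) :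
    ∃ (b : HilbertBasis ℕ ℂ H) (γ : ℕ → ℝ), (∀ n, G (b n) = (γ n : ℂ) • b n) ∧
      (∀ n, γ n ≠ 0) ∧ Function.Injective γ ∧ Tendsto γ cofinite (𝓝 0) := by
  let Λ := {μ : ℂ // Module.End.HasEigenvalue (G : H →ₗ[ℂ] H) μ}
  have hex : ∀ μ : Λ, ∃ x : H, ‖x‖ = 1 ∧ G x = (μ : ℂ) • x := fun μ => by
    obtain ⟨x, hx, hx0⟩ := μ.2.exists_hasEigenvector
    rw [Module.End.mem_eigenspace_iff] at hx
    have hx' : G x = (μ : ℂ) • x := hx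
    refine ⟨((‖x‖ : ℂ)⁻¹) • x, ?_, ?_⟩
    · rw [norm_smul, norm_inv, Complex.norm_real, norm_norm,
        inv_mul_cancel₀ (norm_ne_zero_iff.2 hx0)]
    · rw [map_smul, hx', smul_comm]
  choose v hv1 hv using hex
  have horth : Orthonormal ℂ v := by
    refine ⟨hv1, fun μ ν hne => ?_⟩
    exact hsym.orthogonalFamily_eigenspaces (Subtype.coe_ne_coe.2 hne)
      ⟨v μ, Module.End.mem_eigenspace_iff.2 (hv μ)⟩ ⟨v ν, Module.End.mem_eigenspace_iff.2 (hv ν)⟩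
  have hne0 : ∀ μ : Λ, v μ ≠ 0 := fun μ => horth.ne_zero μ
  have hspan : (Submodule.span ℂ (range v))ᗮ = ⊥ := by
    rw [eq_bot_iff, ← ContinuousLinearMap.orthogonalComplement_iSup_eigenspaces_eq_bot hG hsym]
    refine Submodule.orthogonal_le (iSup_le fun μ => fun x hx => ?_)
    by_cases hx0 : x = 0
    · rw [hx0]
      exact Submodule.zero_mem _
    have hx' : G x = μ • x := Module.End.mem_eigenspace_iff.1 hx
    have hμ : Module.End.HasEigenvalue (G : H →ₗ[ℂ] H) μ :=
      Module.End.hasEigenvalue_of_hasEigenvector ⟨hx, hx0⟩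
    obtain ⟨c, hc⟩ := hsimple μ (v ⟨μ, hμ⟩) x (hv ⟨μ, hμ⟩) (hne0 _) hx'
    rw [hc]
    exact Submodule.smul_mem _ _ (Submodule.subset_span ⟨_, rfl⟩)
  have hμ0 : ∀ μ : Λ, (μ : ℂ) ≠ 0 := fun μ h => by
    have h1 := hv μ
    rw [h, zero_smul] at h1
    exact hne0 μ (hinj (h1.trans (map_zero G).symm))
  have hlim : Tendsto (fun μ : Λ => (μ : ℂ)) cofinite (𝓝 0) :=
    tendsto_eigenvalue_zero hG horth hv
  have hcount : Countable Λ := by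
    have hU : (univ : Set Λ) = ⋃ n : ℕ, {μ : Λ | ¬ dist (μ : ℂ) 0 < 1 / ((n : ℝ) + 1)} := by
      refine (eq_univ_of_forall fun μ => mem_iUnion.2 ?_).symm
      obtain ⟨n, hn⟩ := exists_nat_one_div_lt (norm_pos_iff.2 (hμ0 μ))
      exact ⟨n, by simpa using hn.le⟩
    rw [← countable_univ_iff, hU]
    refine countable_iUnion fun n => Finite.countable ?_
    exact eventually_cofinite.1 (Metric.tendsto_nhds.1 hlim _ (by positivity))
  have hinfin : Infinite Λ := by
    by_contra hfin
    have : Finite Λ := not_infinite_iff_finite.1 hfin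
    have hfd : FiniteDimensional ℂ (Submodule.span ℂ (range v)) :=
      FiniteDimensional.span_of_finite ℂ (finite_range v)
    rw [Submodule.orthogonal_eq_bot_iff] at hspan
    rw [hspan] at hfd
    exact hH (LinearEquiv.finiteDimensional (Submodule.topEquiv (R := ℂ) (M := H)))
  obtain ⟨e⟩ : Nonempty (ℕ ≃ Λ) := nonempty_equiv_of_countable
  have hreal : ∀ μ : Λ, (((μ : ℂ).re : ℝ) : ℂ) = μ := fun μ =>
    Complex.conj_eq_iff_re.1 (hsym.conj_eigenvalue_eq_self μ.2)
  have hspan' : (Submodule.span ℂ (range (v ∘ e)))ᗮ = ⊥ := by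
    rwa [e.surjective.range_comp]
  refine ⟨HilbertBasis.mkOfOrthogonalEqBot (horth.comp e e.injective) hspan',
    fun n => (e n : ℂ).re, fun n => ?_, fun n h => ?_, fun m n h => ?_, ?_⟩
  · rw [HilbertBasis.coe_mkOfOrthogonalEqBot, hreal]
    exact hv (e n)
  · refine hμ0 (e n) ?_
    rw [← hreal]
    simp only at h
    rw [h, Complex.ofReal_zero]
  · refine e.injective (Subtype.ext ?_)
    simp only at h
    rw [← hreal (e m), ← hreal (e n), h]
  · exact (Complex.continuous_re.tendsto' 0 0 rfl).comp (hlim.comp e.injective.tendsto_cofinite)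

end Compact

/-- Polynomials embed: one that vanishes almost everywhere on `(0,1)` vanishes on `[0,1]` by
continuity and has infinitely many roots. -/
lemma L2.not_finiteDimensional : ¬ FiniteDimensional ℂ L2 := by
  intro hfin
  have hm : ∀ p : Polynomial ℂ,
      MemLp (fun z : ℝ => p.eval (z : ℂ)) 2 (volume.restrict (Ioo (0 : ℝ) 1)) := fun p =>
    memLp_of_continuousOn (p.continuous.comp Complex.continuous_ofReal).continuousOn
  let T : Polynomial ℂ →ₗ[ℂ] L2 :=
    { toFun := fun p => (hm p).toLp _
      map_add' := fun p r => by
        rw [← MemLp.toLp_add]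
        congr 1
        ext z
        simp
      map_smul' := fun c p => by
        rw [RingHom.id_apply, ← MemLp.toLp_const_smul]
        congr 1
        ext z
        simp }
  have hT : Function.Injective T := by
    refine (injective_iff_map_eq_zero T).2 fun p hp => ?_
    have h1 : (fun z : ℝ => p.eval (z : ℂ)) =ᵐ[volume.restrict (Icc (0 : ℝ) 1)] fun _ => 0 := by
      rw [← restrict_Ioo_eq_restrict_Icc]
      have h2 := (hm p).coeFn_toLp
      have h3 : (hm p).toLp _ = (0 : L2) := hp
      rw [h3] at h2
      exact h2.symm.trans (Lp.coeFn_zero _ _ _)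
    have h4 := Measure.eqOn_Icc_of_ae_eq volume zero_ne_one h1
      (p.continuous.comp Complex.continuous_ofReal).continuousOn continuousOn_const
    refine p.eq_zero_of_infinite_isRoot (Infinite.mono ?_
      ((Icc_infinite (zero_lt_one : (0 : ℝ) < 1)).image Complex.ofReal_injective.injOn))
    rintro _ ⟨z, hz, rfl⟩
    exact h4 hz
  exact Polynomial.not_finite (Module.Finite.of_injective T hT)

/-! ### The resolvent of the Robin problem -/

/-- The restriction of a bounded continuous function on `[0,1]` to an element of `L₂(0,1)`. -/
def restrictL2 (g : BoundedContinuousFunction (Icc (0 : ℝ) 1) ℂ) : L2 :=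
  BoundedContinuousFunction.toLp 2 (volume.restrict (Ioo (0 : ℝ) 1)) ℂ
    (g.compContinuous ⟨projIcc 0 1 zero_le_one, continuous_projIcc⟩)

lemma continuous_restrictL2 : Continuous restrictL2 :=
  (ContinuousLinearMap.continuous _).comp
    (BoundedContinuousFunction.continuous_compContinuous _)

lemma eq_restrictL2 {h : L2} {u : ℝ → ℂ} (hu : ContinuousOn u (Icc 0 1))
    (hh : ∀ᵐ z ∂(volume.restrict (Ioo (0 : ℝ) 1)), h z = u z) :
    h = restrictL2 (BoundedContinuousFunction.mkOfCompact
      ⟨(Icc (0 : ℝ) 1).domRestrict u, hu.domRestrict⟩) := by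
  refine Lp.ext ?_
  refine EventuallyEq.trans ?_ (BoundedContinuousFunction.coeFn_toLp _ _ _ _).symm
  filter_upwards [hh, ae_restrict_mem measurableSet_Ioo] with z hz hz01
  rw [hz]
  simp [projIcc_of_mem zero_le_one (Ioo_subset_Icc_self hz01), domRestrict]

/-- A set of continuously differentiable functions that is bounded together with the derivatives
is relatively compact in `L₂(0,1)`. -/
lemma exists_compact_of_bound (C : ℝ) : ∃ K : Set L2, IsCompact K ∧
    ∀ (h w : L2) (u v : ℝ → ℂ), IsH2 h w u v →
      (∀ z ∈ Icc (0 : ℝ) 1, ‖u z‖ ≤ C ∧ ‖v z‖ ≤ C) → h ∈ K := by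
  let A : Set (BoundedContinuousFunction (Icc (0 : ℝ) 1) ℂ) :=
    {g | (∀ z, ‖g z‖ ≤ C) ∧ ∀ x y, dist (g x) (g y) ≤ C * dist x y}
  have hA : IsCompact (closure A) := by
    refine BoundedContinuousFunction.arzela_ascoli (Metric.closedBall 0 C)
      (isCompact_closedBall 0 C) A (fun g x hg => by simpa using hg.1 x) ?_
    refine Metric.equicontinuous_of_continuity_modulus (fun t => C * t) ?_ _
      fun x y g => g.2.2 x y
    exact (continuous_const.mul continuous_id).tendsto' 0 0 (by simp)
  refine ⟨restrictL2 '' closure A, hA.image continuous_restrictL2, fun h w u v H hb => ?_⟩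
  rw [eq_restrictL2 H.primitive_fst.continuousOn H.ae_eq]
  refine mem_image_of_mem _ (subset_closure ⟨fun z => (hb z z.2).1, fun x y => ?_⟩)
  rw [dist_eq_norm, Subtype.dist_eq, dist_eq_norm]
  exact (convex_Icc (0 : ℝ) 1).norm_image_sub_le_of_norm_hasDerivWithin_le H.fst_deriv
    (fun z hz => (hb z hz).2) y.2 x.2

/-- `G` inverts `h ↦ h'' - κ² h`. Uniqueness makes the chosen solution linear in `f`; the bounds on
`u` and `v` give continuity and compactness; Green's formula gives symmetry because `κ²` is real. -/
lemma exists_resolvent {q₀ q₁ κ : ℝ} (hκ : κ ≠ 0) (hd : robinDet q₀ q₁ κ ≠ 0) :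
    ∃ G : L2 →L[ℂ] L2, IsCompactOperator G ∧ (G : L2 →ₗ[ℂ] L2).IsSymmetric ∧
      ∀ h f : L2, SLRel q₀ q₁ h (((κ : ℂ) ^ 2) • h + f) ↔ h = G f := by
  obtain ⟨C, hC, hsol⟩ := exists_solution hκ hd
  choose g u v hH h0 h1 hb using hsol
  have hrel : ∀ f, SLRel q₀ q₁ (g f) (((κ : ℂ) ^ 2) • g f + f) := fun f =>
    ⟨u f, v f, hH f, h0 f, h1 f⟩
  have huniq : ∀ h f, SLRel q₀ q₁ h (((κ : ℂ) ^ 2) • h + f) → h = g f := fun h f H => by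
    have H' := H.sub (hrel f)
    have e : ((κ : ℂ) ^ 2) • h + f - (((κ : ℂ) ^ 2) • g f + f) = ((κ : ℂ) ^ 2) • (h - g f) := by
      rw [smul_sub]
      abel
    rw [e] at H'
    exact sub_eq_zero.1 (H'.eq_zero_of_robinDet hd)
  let G₀ : L2 →ₗ[ℂ] L2 :=
    { toFun := g
      map_add' := fun f f' => by
        refine (huniq _ _ ?_).symm
        have H := (hrel f).add (hrel f')
        have e : ((κ : ℂ) ^ 2) • g f + f + (((κ : ℂ) ^ 2) • g f' + f')
            = ((κ : ℂ) ^ 2) • (g f + g f') + (f + f') := by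
          rw [smul_add]
          abel
        rwa [e] at H
      map_smul' := fun c f => by
        refine (huniq _ _ ?_).symm
        have H := (hrel f).smul c
        rwa [smul_add, smul_comm] at H }
  let G : L2 →L[ℂ] L2 := G₀.mkContinuous C fun f =>
    L2.norm_le_of_bound (by positivity) (hH f).ae_eq fun z hz => (hb f z hz).1
  refine ⟨G, ?_, fun f f' => ?_, fun h f => ⟨huniq h f, ?_⟩⟩
  · obtain ⟨K, hK, hKmem⟩ := exists_compact_of_bound C
    refine (isCompactOperator_iff_image_closedBall_subset_compact
      (G : L2 →ₗ[ℂ] L2) zero_lt_one).2 ⟨K, hK, ?_⟩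
    rintro _ ⟨f, hf, rfl⟩
    have hf1 : C * ‖f‖ ≤ C := mul_le_of_le_one_right hC (by simpa using hf)
    exact hKmem _ _ _ _ (hH f) fun z hz =>
      ⟨(hb f z hz).1.trans hf1, (hb f z hz).2.trans hf1⟩
  · have h := (hrel f).inner_comm (hrel f')
    rw [inner_add_left, inner_add_right, inner_smul_left, inner_smul_right, map_pow,
      Complex.conj_ofReal] at h
    exact (add_left_cancel h).symm
  · rintro rfl
    exact hrel f

/-- The Robin problem on `(0,1)` has an orthonormal basis of eigenfunctions, whose eigenvalues are
real, pairwise distinct, bounded above and tend to infinity in absolute value. -/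
theorem exists_robin_eigenbasis (q₀ q₁ : ℝ) : ∃ (b : HilbertBasis ℕ ℂ L2) (θ : ℕ → ℝ) (C : ℝ),
    Function.Injective θ ∧ Tendsto (fun n => |θ n|) cofinite atTop ∧ (∀ n, θ n ≤ C) ∧
      ∀ h w : L2, SLRel q₀ q₁ h w ↔ ∀ n, b.repr w n = θ n * b.repr h n := by
  set κ : ℝ := 2 + 3 * |q₀| + 3 * |q₁| with hκdef
  have hκ : 0 < κ := by positivity
  obtain ⟨G, hGc, hGs, hG⟩ := exists_resolvent hκ.ne' (robinDet_pos q₀ q₁ hκdef.ge).ne'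
  have hinj : Function.Injective G := by
    refine (injective_iff_map_eq_zero G).2 fun f hf => ?_
    obtain ⟨u, v, H, -, -⟩ := (hG 0 f).2 hf.symm
    rw [smul_zero, zero_add] at H
    exact H.eq_zero
  have heig : ∀ (γ : ℂ) (x : L2), γ ≠ 0 → G x = γ • x →
      SLRel q₀ q₁ x (((κ : ℂ) ^ 2 + γ⁻¹) • x) := fun γ x hγ hx => by
    rw [add_smul, hG, map_smul, hx, inv_smul_smul₀ hγ]
  obtain ⟨b, γ, hb, hγ0, hγinj, hγlim⟩ := exists_eigenbasis L2.not_finiteDimensional hGc hGs hinj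
    (fun μ x y hx hx0 hy => by
      have hμ : μ ≠ 0 := by
        rintro rfl
        rw [zero_smul] at hx
        exact hx0 (hinj (hx.trans (map_zero G).symm))
      exact (heig μ x hμ hx).eq_smul_of_eigen hx0 (heig μ y hμ hy))
  -- An eigenvalue `γ` of the resolvent corresponds to the Robin eigenvalue `κ² + γ⁻¹`.
  have hbeig : ∀ n, SLRel q₀ q₁ (b n) (((κ ^ 2 + (γ n)⁻¹ : ℝ) : ℂ) • b n) := fun n => by
    have := heig (γ n) (b n) (by exact_mod_cast hγ0 n) (hb n)
    push_cast
    exact this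
  have hrepr : ∀ f n, b.repr (G f) n = γ n * b.repr f n := fun f n => by
    rw [b.repr_apply_apply, b.repr_apply_apply]
    have := hGs (b n) f
    simp only [ContinuousLinearMap.coe_coe] at this
    rw [← this, hb, inner_smul_left, Complex.conj_ofReal]
  refine ⟨b, fun n => κ ^ 2 + (γ n)⁻¹, κ ^ 2, fun m n h => ?_, ?_, fun n => ?_, fun h w => ?_⟩
  · exact hγinj (inv_injective (add_left_cancel h))
  · have h1 : Tendsto (fun n => |γ n|) cofinite (𝓝[>] 0) := by
      refine tendsto_nhdsWithin_iff.2 ⟨?_, Eventually.of_forall fun n => abs_pos.2 (hγ0 n)⟩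
      simpa using hγlim.abs
    have h2 := tendsto_atTop_add_const_right _ (-κ ^ 2) h1.inv_tendsto_nhdsGT_zero
    refine tendsto_atTop_mono (fun n => ?_) h2
    simp only [Pi.inv_apply]
    rw [← abs_inv]
    rcases abs_cases (γ n)⁻¹ with ⟨e, -⟩ | ⟨e, -⟩ <;>
      linarith [le_abs_self (κ ^ 2 + (γ n)⁻¹), neg_abs_le (κ ^ 2 + (γ n)⁻¹), sq_nonneg κ]
  -- An eigenvalue above `κ²` would be the square of a number at least `κ`, where `robinDet` is
  -- positive.
  · by_contra! hlt
    have hb0 : b n ≠ 0 := b.orthonormal.ne_zero n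
    have hsq : (0 : ℝ) ≤ κ ^ 2 + (γ n)⁻¹ := (sq_nonneg κ).trans hlt.le
    have hle : κ ≤ √(κ ^ 2 + (γ n)⁻¹) := Real.le_sqrt_of_sq_le hlt.le
    have H := hbeig n
    rw [← Real.sq_sqrt hsq, Complex.ofReal_pow] at H
    exact hb0 (H.eq_zero_of_robinDet (robinDet_pos q₀ q₁ hle).ne')
  · have e : ((κ : ℂ) ^ 2) • h + (w - ((κ : ℂ) ^ 2) • h) = w := by abel
    have h1 := hG h (w - ((κ : ℂ) ^ 2) • h)
    rw [e, ← b.repr.injective.eq_iff, lp.ext_iff, funext_iff] at h1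
    rw [h1]
    refine forall_congr' fun n => ?_
    have hγ : (γ n : ℂ) ≠ 0 := by exact_mod_cast hγ0 n
    rw [hrepr, map_sub, map_smul, lp.coeFn_sub, lp.coeFn_smul, Pi.sub_apply, Pi.smul_apply,
      smul_eq_mul]
    push_cast
    constructor
    · intro H
      field_simp
      linear_combination -H
    · intro H
      rw [H]
      field_simp
      ring

/-! ### Simple spectra -/

section Abstract

variable {H : Type*} [NormedAddCommGroup H] [InnerProductSpace ℂ H] {A : H →ₗ.[ℂ] H}

lemma HasSimpleSpectrum.exists_smul (hA : HasSimpleSpectrum A) {ν : ℂ} {x y : H} (hx0 : x ≠ 0)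
    (hx : (x, ν • x) ∈ A.graph) (hy : (y, ν • y) ∈ A.graph) : ∃ c : ℂ, y = c • x := by
  obtain ⟨x', rfl, hx'⟩ := (LinearPMap.mem_graph_iff A).1 hx
  obtain ⟨y', rfl, hy'⟩ := (LinearPMap.mem_graph_iff A).1 hy
  obtain ⟨⟨z, -, -, hz⟩, -⟩ := hA ν ⟨x', hx0, hx'⟩
  obtain ⟨c, hc⟩ := hz x' hx'
  obtain ⟨d, hd⟩ := hz y' hy'
  have hc0 : c ≠ 0 := by
    rintro rfl
    exact hx0 (by simpa using hc)
  exact ⟨d * c⁻¹, by rw [hd, hc, smul_smul, inv_mul_cancel_right₀ hc0]⟩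

lemma HasSimpleSpectrum.eq_zero (hA : HasSimpleSpectrum A) {ν : ℂ} {x y : H}
    (hx : (x, ν • x + y) ∈ A.graph) (hy : (y, ν • y) ∈ A.graph) : y = 0 := by
  by_contra hy0
  obtain ⟨x', rfl, hx'⟩ := (LinearPMap.mem_graph_iff A).1 hx
  obtain ⟨y', rfl, hy'⟩ := (LinearPMap.mem_graph_iff A).1 hy
  refine hy0 ((hA ν ⟨y', hy0, hy'⟩).2 x' y' ?_ hy')
  rw [hx']
  simp

end Abstract

/-- An endomorphism of a finite-dimensional complex space whose eigenvalues have algebraic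
multiplicity one has a basis of eigenvectors with pairwise distinct eigenvalues. -/
lemma exists_basis_of_simple {V : Type*} [AddCommGroup V] [Module ℂ V] [FiniteDimensional ℂ V]
    (f : Module.End ℂ V)
    (h1 : ∀ (ν : ℂ) (x y : V), x ≠ 0 → f x = ν • x → f y = ν • y → ∃ c : ℂ, y = c • x)
    (h2 : ∀ (ν : ℂ) (x y : V), f x = ν • x + y → f y = ν • y → y = 0) :
    ∃ (Λ : Type) (β : Module.Basis Λ ℂ V) (ν : Λ → ℂ), Function.Injective ν ∧
      ∀ i, f (β i) = ν i • β i := by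
  let Λ := {μ : ℂ // f.HasEigenvalue μ}
  have hex : ∀ μ : Λ, ∃ x : V, f.HasEigenvector μ x := fun μ => μ.2.exists_hasEigenvector
  choose v hv using hex
  have hv' : ∀ μ : Λ, f (v μ) = (μ : ℂ) • v μ := fun μ => (hv μ).apply_eq_smul
  have hli : LinearIndependent ℂ v :=
    Module.End.eigenvectors_linearIndependent' f (fun μ : Λ => (μ : ℂ)) Subtype.val_injective v hv
  -- With no Jordan chain of length two, induction on the exponent collapses every generalised
  -- eigenspace to the eigenspace.
  have hgen : ∀ (ν : ℂ) (k : ℕ) (x : V), ((f - ν • (1 : Module.End ℂ V)) ^ k) x = 0 →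
      f x = ν • x := by
    intro ν k
    induction k with
    | zero =>
      intro x hx
      have hx0 : x = 0 := by simpa using hx
      simp [hx0]
    | succ k ih =>
      intro x hx
      rw [pow_succ, Module.End.mul_apply] at hx
      have hy := ih _ hx
      have e : (f - ν • (1 : Module.End ℂ V)) x = f x - ν • x := by simp
      rw [e] at hy
      exact sub_eq_zero.1 (h2 ν x (f x - ν • x) (by abel) hy)
  have hspan : ⊤ ≤ Submodule.span ℂ (range v) := by
    rw [← Module.End.iSup_maxGenEigenspace_eq_top f]
    refine iSup_le fun ν x hx => ?_
    obtain ⟨k, hk⟩ := (Module.End.mem_maxGenEigenspace f ν x).1 hx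
    have hx' := hgen ν k x hk
    by_cases hx0 : x = 0
    · rw [hx0]
      exact Submodule.zero_mem _
    have hν : f.HasEigenvalue ν :=
      Module.End.hasEigenvalue_of_hasEigenvector ⟨Module.End.mem_eigenspace_iff.2 hx', hx0⟩
    obtain ⟨c, hc⟩ := h1 ν (v ⟨ν, hν⟩) x (hv ⟨ν, hν⟩).2 (hv' ⟨ν, hν⟩) hx'
    rw [hc]
    exact Submodule.smul_mem _ _ (Submodule.subset_span ⟨_, rfl⟩)
  refine ⟨Λ, Module.Basis.mk hli hspan, fun μ => μ, Subtype.val_injective, fun μ => ?_⟩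
  rw [Module.Basis.mk_apply]
  exact hv' μ

/-! ### Block triangular operators with diagonal infinite-dimensional part -/

section Triangular

variable {L : Type*} [NormedAddCommGroup L] [InnerProductSpace ℂ L]

/-- All but finitely many `μ n` have distance at least 1 from `ν`; a possible index with `μ n = ν`
is harmless since `0⁻¹ = 0`. -/
lemma exists_bound_inv {μ : ℕ → ℂ} (hlim : Tendsto (fun n => ‖μ n‖) cofinite atTop) (ν : ℂ) :
    ∃ C, ∀ n, ‖(ν - μ n)⁻¹‖ ≤ C := by
  have hfin := eventually_cofinite.1 (hlim.eventually_ge_atTop (‖ν‖ + 1))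
  obtain ⟨C, hC⟩ := (hfin.image fun n => ‖(ν - μ n)⁻¹‖).bddAbove
  refine ⟨max C 1, fun n => ?_⟩
  by_cases hn : ‖ν‖ + 1 ≤ ‖μ n‖
  · refine le_max_of_le_right ?_
    rw [norm_inv]
    refine inv_le_one_of_one_le₀ ?_
    have := norm_sub_norm_le (μ n) ν
    rw [norm_sub_rev] at this
    linarith
  · exact le_max_of_le_left (hC ⟨n, hn, rfl⟩)

/-- Division by `ν - μₙ`, wherever this is nonzero, in the coordinates of a Hilbert basis. -/
lemma exists_div (b : HilbertBasis ℕ ℂ L) {μ : ℕ → ℂ}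
    (hlim : Tendsto (fun n => ‖μ n‖) cofinite atTop) (ν : ℂ) (r : L) :
    ∃ y : L, ∀ n, μ n ≠ ν → (ν - μ n) * b.repr y n = b.repr r n := by
  obtain ⟨C, hC⟩ := exists_bound_inv hlim ν
  refine ⟨b.repr.symm (diagMul (fun n => (ν - μ n)⁻¹) hC (b.repr r)), fun n hn => ?_⟩
  rw [LinearIsometryEquiv.apply_symm_apply, diagMul_apply,
    mul_inv_cancel_left₀ (sub_ne_zero.2 hn.symm)]

variable {nd : ℕ}

/-- The relation `k₁ = S h₁`, `k₂ - N h₁ = A₀ (h₂ - B h₁)`, where `A₀` is the operator that is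
diagonal with eigenvalues `μₙ` with respect to a Hilbert basis. -/
def IsTriangular (A : WithLp 2 (EuclideanSpace ℂ (Fin nd) × L) →ₗ.[ℂ]
      WithLp 2 (EuclideanSpace ℂ (Fin nd) × L))
    (S : Module.End ℂ (EuclideanSpace ℂ (Fin nd))) (B N : EuclideanSpace ℂ (Fin nd) →ₗ[ℂ] L)
    (b : HilbertBasis ℕ ℂ L) (μ : ℕ → ℂ) : Prop :=
  ∀ h k, (h, k) ∈ A.graph ↔ k.fst = S h.fst ∧
    ∀ n, b.repr (k.snd - N h.fst) n = μ n * b.repr (h.snd - B h.fst) n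

variable {A : WithLp 2 (EuclideanSpace ℂ (Fin nd) × L) →ₗ.[ℂ]
      WithLp 2 (EuclideanSpace ℂ (Fin nd) × L)}
    {S : Module.End ℂ (EuclideanSpace ℂ (Fin nd))} {B N : EuclideanSpace ℂ (Fin nd) →ₗ[ℂ] L}
    {b : HilbertBasis ℕ ℂ L} {μ : ℕ → ℂ}

namespace IsTriangular

/-- With `c = 1` this supplies an eigenvector; the free scalar lets the same vector serve as the end
of a potential Jordan chain. -/
lemma basis_mem_graph (hA : IsTriangular A S B N b μ) (m : ℕ) (c : ℂ) :
    ((WithLp.toLp 2 (0, c • b m) : WithLp 2 (EuclideanSpace ℂ (Fin nd) × L)),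
      μ m • (WithLp.toLp 2 (0, c • b m) : WithLp 2 (EuclideanSpace ℂ (Fin nd) × L))) ∈ A.graph := by
  classical
  rw [hA]
  refine ⟨by simp, fun n => ?_⟩
  simp only [WithLp.smul_snd, WithLp.toLp_fst, WithLp.toLp_snd, map_zero, sub_zero, map_smul,
    b.repr_self, lp.coeFn_smul, Pi.smul_apply, smul_eq_mul]
  rcases eq_or_ne n m with rfl | hn
  · rfl
  · rw [lp.single_apply_ne _ _ _ hn]
    ring

/-- Solvability of `A x = ν x + (e', f)` with prescribed first component. -/
lemma exists_lift (hA : IsTriangular A S B N b μ)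
    (hlim : Tendsto (fun n => ‖μ n‖) cofinite atTop) {ν : ℂ}
    {e e' : EuclideanSpace ℂ (Fin nd)} (he : S e = ν • e + e') (f : L) (hν : ∀ n, μ n ≠ ν) :
    ∃ y : L, ((WithLp.toLp 2 (e, y) : WithLp 2 (EuclideanSpace ℂ (Fin nd) × L)),
      ν • (WithLp.toLp 2 (e, y) : WithLp 2 (EuclideanSpace ℂ (Fin nd) × L))
        + WithLp.toLp 2 (e', f)) ∈ A.graph := by
  obtain ⟨y, hy⟩ := exists_div b hlim ν (N e - f - ν • B e)
  refine ⟨B e + y, (hA _ _).2 ⟨by simp [he], fun n => ?_⟩⟩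
  have h := hy n (hν n)
  simp only [WithLp.add_snd, WithLp.smul_snd, WithLp.toLp_fst, WithLp.toLp_snd, map_sub, map_add,
    map_smul, lp.coeFn_smul, lp.coeFn_add, lp.coeFn_sub, Pi.sub_apply, Pi.add_apply,
    Pi.smul_apply, smul_eq_mul] at h ⊢
  linear_combination h

/-- If `S e = μ m • e`, the second component can be solved for except in coordinate `m`, where the
obstruction is `c`. This gives `(A - μ m) x = (0, c • b m)`, and the absence of Jordan chains forces
the right-hand side to vanish. Then `x` is an eigenvector with first component `e ≠ 0`, independent
of `(0, b m)`: the eigenspace is not a line. -/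
lemma eigenvalue_ne (hA : IsTriangular A S B N b μ) (hs : HasSimpleSpectrum A)
    (hinj : Function.Injective μ) (hlim : Tendsto (fun n => ‖μ n‖) cofinite atTop) {ν : ℂ}
    {e : EuclideanSpace ℂ (Fin nd)} (he : S e = ν • e) (he0 : e ≠ 0) (m : ℕ) : μ m ≠ ν := by
  classical
  rintro rfl
  obtain ⟨y, hy⟩ := exists_div b hlim (μ m) (N e - μ m • B e)
  set c : ℂ := b.repr (N e - μ m • B e) m with hc
  have hx : ((WithLp.toLp 2 (e, B e + y) : WithLp 2 (EuclideanSpace ℂ (Fin nd) × L)),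
      μ m • (WithLp.toLp 2 (e, B e + y) : WithLp 2 (EuclideanSpace ℂ (Fin nd) × L))
        + WithLp.toLp 2 (0, c • b m)) ∈ A.graph := by
    rw [hA]
    refine ⟨by simp [he], fun n => ?_⟩
    simp only [WithLp.add_snd, WithLp.smul_snd, WithLp.toLp_fst, WithLp.toLp_snd, map_sub,
      map_add, map_smul, lp.coeFn_smul, lp.coeFn_add, lp.coeFn_sub, Pi.sub_apply, Pi.add_apply,
      Pi.smul_apply, smul_eq_mul, b.repr_self] at hy hc ⊢
    rcases eq_or_ne n m with rfl | hn
    · rw [lp.single_apply_self, hc]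
      ring
    · rw [lp.single_apply_ne _ _ _ hn]
      linear_combination hy n (hinj.ne hn)
  have h0 := hs.eq_zero hx (hA.basis_mem_graph m c)
  rw [h0, add_zero] at hx
  have hb := hA.basis_mem_graph m 1
  have hb0 : (WithLp.toLp 2 (0, (1 : ℂ) • b m) : WithLp 2 (EuclideanSpace ℂ (Fin nd) × L)) ≠ 0 := by
    intro h
    have h' := congrArg WithLp.snd h
    simp only [one_smul, WithLp.toLp_snd, WithLp.zero_snd] at h'
    exact b.orthonormal.ne_zero m h'
  obtain ⟨d, hd⟩ := hs.exists_smul hb0 hb hx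
  have := congrArg WithLp.fst hd
  simp only [WithLp.smul_fst, WithLp.toLp_fst, smul_zero] at this
  exact he0 this

/-- As no eigenvalue of `S` is a `μ n`, eigenvectors and length-two chains of `S` lift to `A` with
prescribed first component, and simplicity descends to `S`. -/
lemma exists_basis (hA : IsTriangular A S B N b μ) (hs : HasSimpleSpectrum A)
    (hinj : Function.Injective μ) (hlim : Tendsto (fun n => ‖μ n‖) cofinite atTop) :
    ∃ (β : Module.Basis (Fin nd) ℂ (EuclideanSpace ℂ (Fin nd))) (ν : Fin nd → ℂ),
      Function.Injective ν ∧ ∀ i, S (β i) = ν i • β i := by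
  have h0 : (WithLp.toLp 2 (0, 0) : WithLp 2 (EuclideanSpace ℂ (Fin nd) × L)) = 0 := rfl
  have hlift : ∀ (ν : ℂ) (x : EuclideanSpace ℂ (Fin nd)), x ≠ 0 → S x = ν • x →
      ∀ y : EuclideanSpace ℂ (Fin nd), S y = ν • y → ∃ w : L,
        ((WithLp.toLp 2 (y, w) : WithLp 2 (EuclideanSpace ℂ (Fin nd) × L)),
          ν • (WithLp.toLp 2 (y, w) : WithLp 2 (EuclideanSpace ℂ (Fin nd) × L))) ∈ A.graph := by
    intro ν x hx0 hx y hy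
    obtain ⟨w, hw⟩ := hA.exists_lift hlim (e' := 0) (by rw [hy, add_zero]) 0
      fun n => hA.eigenvalue_ne hs hinj hlim hx hx0 n
    rw [h0, add_zero] at hw
    exact ⟨w, hw⟩
  have h1 : ∀ (ν : ℂ) (x y : EuclideanSpace ℂ (Fin nd)), x ≠ 0 → S x = ν • x → S y = ν • y →
      ∃ c : ℂ, y = c • x := by
    intro ν x y hx0 hx hy
    obtain ⟨z, hz⟩ := hlift ν x hx0 hx x hx
    obtain ⟨w, hw⟩ := hlift ν x hx0 hx y hy
    have hne : (WithLp.toLp 2 (x, z) : WithLp 2 (EuclideanSpace ℂ (Fin nd) × L)) ≠ 0 :=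
      fun h => hx0 (congrArg WithLp.fst h)
    obtain ⟨c, hc⟩ := hs.exists_smul hne hz hw
    exact ⟨c, congrArg WithLp.fst hc⟩
  have h2 : ∀ (ν : ℂ) (x y : EuclideanSpace ℂ (Fin nd)), S x = ν • x + y → S y = ν • y →
      y = 0 := by
    intro ν x y hx hy
    by_contra hy0
    obtain ⟨w, hw⟩ := hlift ν y hy0 hy y hy
    obtain ⟨z, hz⟩ := hA.exists_lift hlim hx w
      fun n => hA.eigenvalue_ne hs hinj hlim hy hy0 n
    exact hy0 (congrArg WithLp.fst (hs.eq_zero hz hw))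
  obtain ⟨Λ, β, ν, hν, hβ⟩ := exists_basis_of_simple S h1 h2
  let e := β.indexEquiv (EuclideanSpace.basisFun (Fin nd) ℂ).toBasis
  exact ⟨β.reindex e, ν ∘ e.symm, hν.comp e.symm.injective, fun i => by simp [hβ]⟩

end IsTriangular

/-- The Hilbert basis of `ℂⁿ ⊕ L` obtained from the standard basis and a Hilbert basis of `L`. -/
lemma exists_sum_basis [CompleteSpace L] (b : HilbertBasis ℕ ℂ L) (nd : ℕ) :
    ∃ W : HilbertBasis (Fin nd ⊕ ℕ) ℂ (WithLp 2 (EuclideanSpace ℂ (Fin nd) × L)),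
      (∀ z j, W.repr z (Sum.inl j) = z.fst j) ∧
      ∀ z n, W.repr z (Sum.inr n) = b.repr z.snd n := by
  classical
  let w : Fin nd ⊕ ℕ → WithLp 2 (EuclideanSpace ℂ (Fin nd) × L) :=
    Sum.elim (fun j => WithLp.toLp 2 (EuclideanSpace.single j 1, 0))
      (fun n => WithLp.toLp 2 (0, b n))
  have h1 : ∀ z j, inner ℂ (w (Sum.inl j)) z = z.fst j := fun z j => by
    simp [w, WithLp.prod_inner_apply, EuclideanSpace.inner_single_left]
  have h2 : ∀ z n, inner ℂ (w (Sum.inr n)) z = b.repr z.snd n := fun z n => by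
    simp [w, WithLp.prod_inner_apply, b.repr_apply_apply]
  have horth : Orthonormal ℂ w := by
    rw [orthonormal_iff_ite]
    rintro (i | i) (j | j)
    · rw [h1]
      simp [w]
    · simp [w]
    · simp [w]
    · rw [h2]
      simp only [w, Sum.elim_inr, WithLp.toLp_snd, b.repr_self, Sum.inr.injEq]
      rw [lp.single_apply, Pi.single_apply]
  have hspan : (Submodule.span ℂ (range w))ᗮ = ⊥ := by
    rw [eq_bot_iff]
    intro z hz
    have h0 : ∀ i, inner ℂ (w i) z = 0 := fun i =>
      (Submodule.mem_orthogonal _ _).1 hz _ (Submodule.subset_span ⟨i, rfl⟩)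
    refine WithLp.ofLp_injective 2 (Prod.ext ?_ ?_)
    · ext j
      exact (h1 z j).symm.trans (h0 _)
    · refine b.repr.injective ?_
      ext n
      rw [← WithLp.snd, ← h2, h0]
      simp
  refine ⟨HilbertBasis.mkOfOrthogonalEqBot horth hspan, fun z j => ?_, fun z n => ?_⟩
  · rw [HilbertBasis.repr_apply_apply, HilbertBasis.coe_mkOfOrthogonalEqBot, h1]
  · rw [HilbertBasis.repr_apply_apply, HilbertBasis.coe_mkOfOrthogonalEqBot, h2]

/-- The change of coordinates `(x, y) ↦ (Q x, y - M x)` on `ℂⁿ ⊕ L`. -/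
def shear (Q : EuclideanSpace ℂ (Fin nd) ≃ₗ[ℂ] EuclideanSpace ℂ (Fin nd))
    (M : EuclideanSpace ℂ (Fin nd) →ₗ[ℂ] L) :
    WithLp 2 (EuclideanSpace ℂ (Fin nd) × L) ≃L[ℂ] WithLp 2 (EuclideanSpace ℂ (Fin nd) × L) where
  toFun z := WithLp.toLp 2 (Q z.fst, z.snd - M z.fst)
  invFun z := WithLp.toLp 2 (Q.symm z.fst, z.snd + M (Q.symm z.fst))
  map_add' x y := by
    refine WithLp.ofLp_injective 2 (Prod.ext ?_ ?_)
    · simp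
    · simp
      abel
  map_smul' c x := by
    refine WithLp.ofLp_injective 2 (Prod.ext ?_ ?_)
    · simp
    · simp [smul_sub]
  left_inv z := by
    refine WithLp.ofLp_injective 2 (Prod.ext ?_ ?_)
    · simp
    · simp
  right_inv z := by
    refine WithLp.ofLp_injective 2 (Prod.ext ?_ ?_)
    · simp
    · simp
  continuous_toFun := by
    have hQ : Continuous Q := Q.toContinuousLinearEquiv.continuous
    have hM : Continuous M := M.continuous_of_finiteDimensional
    exact (WithLp.prod_continuous_toLp 2 _ _).comp
      ((hQ.comp (WithLp.continuous_fst 2 (EuclideanSpace ℂ (Fin nd)) L)).prodMk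
        ((WithLp.continuous_snd 2 (EuclideanSpace ℂ (Fin nd)) L).sub
          (hM.comp (WithLp.continuous_fst 2 (EuclideanSpace ℂ (Fin nd)) L))))
  continuous_invFun := by
    have hQ : Continuous Q.symm := Q.symm.toContinuousLinearEquiv.continuous
    have hM : Continuous M := M.continuous_of_finiteDimensional
    have hQf := hQ.comp (WithLp.continuous_fst 2 (EuclideanSpace ℂ (Fin nd)) L)
    exact (WithLp.prod_continuous_toLp 2 _ _).comp
      (hQf.prodMk ((WithLp.continuous_snd 2 (EuclideanSpace ℂ (Fin nd)) L).add (hM.comp hQf)))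

/-- Decoupling requires `M` with `M S - N = A₀ (M - B)`, where `A₀` is the diagonal block. On an
eigenvector of `S` this is an equation for `ν j - A₀`, solvable because `ν j` differs from every `μ
n`. -/
theorem IsTriangular.exists_isDiagonal [CompleteSpace L] (hA : IsTriangular A S B N b μ)
    (hs : HasSimpleSpectrum A) (hinj : Function.Injective μ)
    (hlim : Tendsto (fun n => ‖μ n‖) cofinite atTop) :
    ∃ (Ψ : lp (fun _ : Fin nd ⊕ ℕ => ℂ) 2 ≃L[ℂ] WithLp 2 (EuclideanSpace ℂ (Fin nd) × L))
      (ν : Fin nd → ℂ), IsDiagonal A Ψ (Sum.elim ν μ) ∧ Function.Injective (Sum.elim ν μ) := by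
  obtain ⟨β, ν, hν, hβ⟩ := hA.exists_basis hs hinj hlim
  have hne : ∀ j n, μ n ≠ ν j := fun j n => hA.eigenvalue_ne hs hinj hlim (hβ j) (β.ne_zero j) n
  have hy : ∀ j, ∃ y : L, ∀ n, b.repr (ν j • y - N (β j)) n = μ n * b.repr (y - B (β j)) n := by
    intro j
    obtain ⟨y, hy⟩ := hA.exists_lift hlim (e' := 0) (by rw [hβ, add_zero]) 0 (hne j)
    refine ⟨y, fun n => ?_⟩
    simpa using ((hA _ _).1 hy).2 n
  choose y hy using hy
  set M : EuclideanSpace ℂ (Fin nd) →ₗ[ℂ] L := β.constr ℂ y with hM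
  have hMβ : ∀ j, M (β j) = y j := fun j => β.constr_basis ℂ y j
  have hMS : ∀ (x : EuclideanSpace ℂ (Fin nd)) (n : ℕ),
      b.repr (M (S x) - N x) n = μ n * b.repr (M x - B x) n := by
    intro x n
    -- The `n`-th coordinate of the defect in the Sylvester equation, a linear functional that need
    -- only vanish on `β`.
    let F : EuclideanSpace ℂ (Fin nd) →ₗ[ℂ] ℂ :=
      (coordCLM n : lp (fun _ : ℕ => ℂ) 2 →ₗ[ℂ] ℂ) ∘ₗ
        (b.repr.toLinearEquiv : L →ₗ[ℂ] lp (fun _ : ℕ => ℂ) 2) ∘ₗ ((M ∘ₗ S - N) - μ n • (M - B))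
    have hF : F = 0 := β.ext fun j => by
      have := hy j n
      simp only [F, LinearMap.comp_apply, LinearMap.sub_apply, LinearMap.smul_apply, hβ, map_smul,
        hMβ, LinearMap.zero_apply]
      change b.repr (ν j • y j - N (β j) - μ n • (y j - B (β j))) n = 0
      rw [map_sub b.repr (ν j • y j - N (β j)), lp.coeFn_sub, Pi.sub_apply, this, map_smul,
        lp.coeFn_smul, Pi.smul_apply, smul_eq_mul, sub_self]
    have hx : b.repr (M (S x) - N x - μ n • (M x - B x)) n = 0 := LinearMap.congr_fun hF x
    rw [map_sub b.repr (M (S x) - N x), lp.coeFn_sub, Pi.sub_apply, map_smul,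
        lp.coeFn_smul, Pi.smul_apply, smul_eq_mul] at hx
    exact sub_eq_zero.1 hx
  obtain ⟨W, hW1, hW2⟩ := exists_sum_basis b nd
  let Q : EuclideanSpace ℂ (Fin nd) ≃ₗ[ℂ] EuclideanSpace ℂ (Fin nd) :=
    β.equivFun.trans (WithLp.linearEquiv 2 ℂ (Fin nd → ℂ)).symm
  have hQ : ∀ x j, Q x j = β.repr x j := fun x j => rfl
  have hSβ : ∀ x j, β.repr (S x) j = ν j * β.repr x j := by
    intro x j
    have hF : β.coord j ∘ₗ S = ν j • β.coord j := β.ext fun i => by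
      simp only [LinearMap.comp_apply, LinearMap.smul_apply, hβ, map_smul, Module.Basis.coord_apply,
        smul_eq_mul, Module.Basis.repr_self]
      rcases eq_or_ne i j with rfl | hij
      · rfl
      · rw [Finsupp.single_eq_of_ne' hij, mul_zero, mul_zero]
    exact LinearMap.congr_fun hF x
  have hc1 : ∀ z j, W.repr (shear Q M z) (Sum.inl j) = β.repr z.fst j := fun z j => hW1 _ j
  have hc2 : ∀ z n, W.repr (shear Q M z) (Sum.inr n) = b.repr (z.snd - M z.fst) n :=
    fun z n => hW2 _ n
  refine ⟨((shear Q M).trans W.repr.toContinuousLinearEquiv).symm, ν, fun h k => ?_,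
    hν.sumElim hinj fun j n h => hne j n h.symm⟩
  rw [ContinuousLinearEquiv.symm_symm, hA, Sum.forall]
  change _ ↔ (∀ j, W.repr (shear Q M k) (Sum.inl j) = ν j * W.repr (shear Q M h) (Sum.inl j)) ∧
    ∀ n, W.repr (shear Q M k) (Sum.inr n) = μ n * W.repr (shear Q M h) (Sum.inr n)
  have hfst : k.fst = S h.fst ↔
      ∀ j, W.repr (shear Q M k) (Sum.inl j) = ν j * W.repr (shear Q M h) (Sum.inl j) := by
    simp_rw [hc1, ← hSβ]
    exact ⟨fun h j => by rw [h], fun h => β.ext_elem h⟩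
  rw [← hfst]
  refine and_congr_right fun hk => forall_congr' fun n => ?_
  -- Subtracting this identity replaces `N` by `M S` and `B` by `M` in the graph relation.
  have hx := hMS h.fst n
  rw [hc2, hc2, hk]
  simp only [map_sub, lp.coeFn_sub, Pi.sub_apply] at hx ⊢
  constructor
  · intro H
    linear_combination H - hx
  · intro H
    linear_combination H + hx

theorem IsTriangular.isRieszSpectral_isWellPosed [CompleteSpace L]
    (hA : IsTriangular A S B N b μ)
    (hs : HasSimpleSpectrum A) (hinj : Function.Injective μ)
    (hlim : Tendsto (fun n => ‖μ n‖) cofinite atTop) {ω : ℝ} (hω : ∀ n, (μ n).re ≤ ω) :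
    IsRieszSpectral A ∧ IsWellPosed A := by
  obtain ⟨Ψ, ν, hD, hinj'⟩ := hA.exists_isDiagonal hs hinj hlim
  obtain ⟨e⟩ : Nonempty (ℕ ≃ Fin nd ⊕ ℕ) := nonempty_equiv_of_countable
  obtain ⟨ω', hω'⟩ := (finite_range fun j => (ν j).re).bddAbove
  refine ⟨hD.isRieszSpectral e hinj' ?_, hD.isWellPosed (ω := max ω' ω) ?_⟩
  · refine tendsto_atTop.2 fun C => eventually_cofinite.2 ?_
    have h := eventually_cofinite.1 (tendsto_atTop.1 hlim C)
    refine ((finite_range (Sum.inl : Fin nd → Fin nd ⊕ ℕ)).union (h.image Sum.inr)).subset ?_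
    rintro (j | n) hn
    · exact Or.inl ⟨j, rfl⟩
    · exact Or.inr ⟨n, hn, rfl⟩
  · rintro (j | n)
    · exact le_max_of_le_left (hω' ⟨j, rfl⟩)
    · exact le_max_of_le_right (hω n)

end Triangular

/-! ### The coupled system -/

section Coupled

variable {nd q : ℕ} (a q₀ q₁ : ℝ) (g₁ : ℝ → Fin q → ℝ) (g₂ g₃ : Fin q → ℝ)
  (S : Matrix (Fin nd) (Fin nd) ℝ) (P : Matrix (Fin q) (Fin nd) ℝ)

/-- The real matrix `S` as an endomorphism of `ℂⁿ`. -/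
def actEnd (S : Matrix (Fin nd) (Fin nd) ℝ) : Module.End ℂ (EuclideanSpace ℂ (Fin nd)) where
  toFun x := WithLp.toLp 2 (act S x)
  map_add' x y := by
    ext i
    simp [act_add]
  map_smul' c x := by
    ext i
    simp [act_smul]

lemma isH2_of_hasDerivAt {u v w : ℝ → ℂ} (hu : ∀ z, HasDerivAt u (v z) z)
    (hv : ∀ z, HasDerivAt v (w z) z) (hw : Continuous w) : ∃ h h'' : L2, IsH2 h h'' u v := by
  have hvc : Continuous v := continuous_iff_continuousAt.2 fun z => (hv z).continuousAt
  have huc : Continuous u := continuous_iff_continuousAt.2 fun z => (hu z).continuousAt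
  obtain ⟨h, hh⟩ := exists_L2_of_continuousOn huc.continuousOn
  obtain ⟨h'', hh''⟩ := exists_L2_of_continuousOn hw.continuousOn
  refine ⟨h, h'', IsH2.of_primitive hh (Primitive.of_hasDerivAt hu hvc)
    ((Primitive.of_hasDerivAt hv hw).congr_density ?_)⟩
  filter_upwards [hh''] with z hz
  exact hz.symm

/-- The Hermite cubics `z (z - 1)²` and `z² (z - 1)`: both vanish at both endpoints, so the Robin
terms drop out, and each has slope 1 at one endpoint and 0 at the other. -/
lemma exists_boundary_functions (q₀ q₁ : ℝ) : ∃ (h h'' r r'' : L2) (u v x y : ℝ → ℂ),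
    IsH2 h h'' u v ∧ IsH2 r r'' x y ∧ v 0 = q₀ * u 0 + 1 ∧ v 1 = q₁ * u 1 ∧
      y 0 = q₀ * x 0 ∧ y 1 = q₁ * x 1 + 1 := by
  have hd : ∀ z : ℝ, HasDerivAt (fun z : ℝ => (z : ℂ)) 1 z := fun z => (hasDerivAt_id z).ofReal_comp
  obtain ⟨h, h'', H⟩ := isH2_of_hasDerivAt (u := fun z => z ^ 3 - 2 * z ^ 2 + z)
    (v := fun z => 3 * z ^ 2 - 4 * z + 1) (w := fun z => 6 * z - 4)
    (fun z => ((((hd z).pow 3).sub (((hd z).pow 2).const_mul 2)).add (hd z)).congr_deriv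
      (by push_cast; ring))
    (fun z => (((((hd z).pow 2).const_mul 3).sub ((hd z).const_mul 4)).add_const 1).congr_deriv
      (by push_cast; ring)) (by fun_prop)
  obtain ⟨r, r'', R⟩ := isH2_of_hasDerivAt (u := fun z => z ^ 3 - z ^ 2)
    (v := fun z => 3 * z ^ 2 - 2 * z) (w := fun z => 6 * z - 2)
    (fun z => (((hd z).pow 3).sub ((hd z).pow 2)).congr_deriv (by push_cast; ring))
    (fun z => ((((hd z).pow 2).const_mul 3).sub ((hd z).const_mul 2)).congr_deriv
      (by push_cast; ring)) (by fun_prop)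
  exact ⟨h, h'', r, r'', _, _, _, _, H, R, by norm_num, by norm_num, by norm_num, by norm_num⟩

/-- `gᵀ P` as a linear functional on `ℂⁿ`. -/
def pairLin (g : Fin q → ℝ) (P : Matrix (Fin q) (Fin nd) ℝ) :
    EuclideanSpace ℂ (Fin nd) →ₗ[ℂ] ℂ where
  toFun := pair g P
  map_add' := pair_add g P
  map_smul' := pair_smul g P

/-- Functions in `H²(0,1)` with the prescribed inhomogeneous boundary conditions, depending
linearly on the boundary data. -/
lemma exists_boundary_lift : ∃ B B'' : EuclideanSpace ℂ (Fin nd) →ₗ[ℂ] L2,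
    ∀ x, ∃ u v : ℝ → ℂ, IsH2 (B x) (B'' x) u v ∧ v 0 = q₀ * u 0 + pair g₂ P x ∧
      v 1 = q₁ * u 1 + pair g₃ P x := by
  obtain ⟨h, h'', r, r'', u, v, y, z, H, R, e1, e2, e3, e4⟩ := exists_boundary_functions q₀ q₁
  refine ⟨(pairLin g₂ P).smulRight h + (pairLin g₃ P).smulRight r,
    (pairLin g₂ P).smulRight h'' + (pairLin g₃ P).smulRight r'', fun x => ?_⟩
  refine ⟨_, _, (H.smul (pair g₂ P x)).add (R.smul (pair g₃ P x)), ?_, ?_⟩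
  · rw [e1, e3]
    ring
  · rw [e2, e4]
    ring

lemma exists_source {g₁ : ℝ → Fin q → ℝ}
    (hg₁ : ∀ i, MemLp (fun z => g₁ z i) 2 (volume.restrict (Ioo (0 : ℝ) 1))) :
    ∃ G : EuclideanSpace ℂ (Fin nd) →ₗ[ℂ] L2, ∀ x,
      ∀ᵐ z ∂(volume.restrict (Ioo (0 : ℝ) 1)), G x z = pair (g₁ z) P x := by
  have hm : ∀ i, MemLp (fun z => (g₁ z i : ℂ)) 2 (volume.restrict (Ioo (0 : ℝ) 1)) :=
    fun i => (hg₁ i).ofReal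
  let pr : Fin q → EuclideanSpace ℂ (Fin nd) →ₗ[ℂ] ℂ := fun i =>
    { toFun := fun x => act P x i
      map_add' := fun x y => act_add P x y i
      map_smul' := fun c x => act_smul P c x i }
  refine ⟨∑ i, (pr i).smulRight ((hm i).toLp _), fun x => ?_⟩
  have h1 : ∀ᵐ z ∂(volume.restrict (Ioo (0 : ℝ) 1)), ∀ i,
      (act P x i • (hm i).toLp _ : L2) z = act P x i * g₁ z i := by
    refine ae_all_iff.2 fun i => ?_
    filter_upwards [Lp.coeFn_smul (act P x i) ((hm i).toLp _), (hm i).coeFn_toLp] with z e1 e2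
    rw [e1, Pi.smul_apply, e2, smul_eq_mul]
  have h2 : (∑ i, (pr i).smulRight ((hm i).toLp _)) x
      = ∑ i, (act P x i • (hm i).toLp _ : L2) := by
    rw [LinearMap.sum_apply]
    rfl
  rw [h2]
  filter_upwards [h1, Lp.coeFn_finsetSum Finset.univ fun i => (act P x i • (hm i).toLp _ : L2)]
    with z e1 e2
  rw [e2, Finset.sum_apply, pair]
  exact Finset.sum_congr rfl fun i _ => by rw [e1, mul_comm]

/-- Subtracting the lift `B h₁` makes the boundary conditions homogeneous, and `ρ ≠ 0` allows
solving for the second derivative. -/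
lemma extRel_iff {ρ : ℝ} (hρ : ρ ≠ 0) {B B'' G : EuclideanSpace ℂ (Fin nd) →ₗ[ℂ] L2}
    (hB : ∀ x, ∃ u v : ℝ → ℂ, IsH2 (B x) (B'' x) u v ∧ v 0 = q₀ * u 0 + pair g₂ P x ∧
      v 1 = q₁ * u 1 + pair g₃ P x)
    (hG : ∀ x, ∀ᵐ z ∂(volume.restrict (Ioo (0 : ℝ) 1)), G x z = pair (g₁ z) P x)
    (h k : State nd) :
    ExtRel ρ a q₀ q₁ g₁ g₂ g₃ S P h k ↔ k.fst = actEnd S h.fst ∧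
      SLRel q₀ q₁ (h.snd - B h.fst)
        ((ρ : ℂ)⁻¹ • (k.snd - (a : ℂ) • h.snd - G h.fst) - B'' h.fst) := by
  have hρ' : (ρ : ℂ) ≠ 0 := by exact_mod_cast hρ
  obtain ⟨y, z, HB, b0, b1⟩ := hB h.fst
  have hS : (∀ i, k.fst i = act S h.fst i) ↔ k.fst = actEnd S h.fst :=
    ⟨fun H => by ext i; exact H i, fun H i => by rw [H]; rfl⟩
  have hk : ∀ w : L2, (∀ᵐ z ∂(volume.restrict (Ioo (0 : ℝ) 1)),
      k.snd z = ρ * w z + a * h.snd z + pair (g₁ z) P h.fst) ↔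
        w = (ρ : ℂ)⁻¹ • (k.snd - (a : ℂ) • h.snd - G h.fst) := by
    intro w
    have h1 : (w = (ρ : ℂ)⁻¹ • (k.snd - (a : ℂ) • h.snd - G h.fst)) ↔
        k.snd = (ρ : ℂ) • w + (a : ℂ) • h.snd + G h.fst := by
      rw [eq_inv_smul_iff₀ hρ', sub_sub, eq_sub_iff_add_eq, add_assoc, eq_comm]
    rw [h1]
    have h2 : ⇑((ρ : ℂ) • w + (a : ℂ) • h.snd + G h.fst) =ᵐ[volume.restrict (Ioo (0 : ℝ) 1)]
        fun z => ρ * w z + a * h.snd z + pair (g₁ z) P h.fst := by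
      filter_upwards [Lp.coeFn_add ((ρ : ℂ) • w + (a : ℂ) • h.snd) (G h.fst),
        Lp.coeFn_add ((ρ : ℂ) • w) ((a : ℂ) • h.snd), Lp.coeFn_smul (ρ : ℂ) w,
        Lp.coeFn_smul (a : ℂ) h.snd, hG h.fst] with z e1 e2 e3 e4 e5
      rw [e1, Pi.add_apply, e2, Pi.add_apply, e3, e4, e5]
      rfl
    exact ⟨fun H => Lp.ext (EventuallyEq.trans H h2.symm), fun H => by rw [H]; exact h2⟩
  constructor
  · rintro ⟨w, u, v, H, h0, h1, hS', hk'⟩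
    refine ⟨hS.1 hS', ?_⟩
    rw [← (hk w).1 hk']
    have HH := H.add (HB.smul (-1))
    simp only [neg_smul, one_smul, ← sub_eq_add_neg] at HH
    exact ⟨_, _, HH, by rw [h0, b0]; ring, by rw [h1, b1]; ring⟩
  · rintro ⟨hS', u, v, H, h0, h1⟩
    have HH := H.add HB
    simp only [sub_add_cancel] at HH
    exact ⟨_, _, _, HH, by rw [h0, b0]; ring, by rw [h1, b1]; ring, hS.2 hS', (hk _).2 rfl⟩

end Coupled

end ExtSys

end

/-! ### The extended operator in triangular form -/

theorem lemma1 {nd q : ℕ} (ρ a q₀ q₁ : ℝ) (hρ : 0 < ρ)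
    (g₁ : ℝ → Fin q → ℝ)
    (hg₁ : ∀ i, MeasureTheory.MemLp (fun z => g₁ z i) 2
      (MeasureTheory.volume.restrict (Set.Ioo (0 : ℝ) 1)))
    (g₂ g₃ : Fin q → ℝ)
    (S : Matrix (Fin nd) (Fin nd) ℝ) (P : Matrix (Fin q) (Fin nd) ℝ)
    (hsimple : ExtSys.HasSimpleSpectrum (ExtSys.extOp ρ a q₀ q₁ g₁ g₂ g₃ S P)) :
    ExtSys.IsRieszSpectral (ExtSys.extOp ρ a q₀ q₁ g₁ g₂ g₃ S P) ∧
    ExtSys.IsWellPosed (ExtSys.extOp ρ a q₀ q₁ g₁ g₂ g₃ S P) := by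
  obtain ⟨B, B'', hB⟩ := ExtSys.exists_boundary_lift q₀ q₁ g₂ g₃ P
  obtain ⟨G, hG⟩ := ExtSys.exists_source P hg₁
  obtain ⟨b, θ, C, hinj, hlim, hC, hdiag⟩ := ExtSys.exists_robin_eigenbasis q₀ q₁
  have hρ' : (ρ : ℂ) ≠ 0 := by exact_mod_cast hρ.ne'
  -- The terms of `N`: the source `G`, the second derivative of the lift times `ρ`, and `a • B` from
  -- writing `a h₂` as `a (h₂ - B h₁) + a B h₁`.
  have hA : ExtSys.IsTriangular (ExtSys.extOp ρ a q₀ q₁ g₁ g₂ g₃ S P) (ExtSys.actEnd S) B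
      (G + (ρ : ℂ) • B'' + (a : ℂ) • B) b (fun n => ((a + ρ * θ n : ℝ) : ℂ)) := by
    intro h k
    rw [ExtSys.mem_graph_extOp, ExtSys.extRel_iff a q₀ q₁ g₁ g₂ g₃ S P hρ.ne' hB hG, hdiag]
    refine and_congr_right fun _ => forall_congr' fun n => ?_
    simp only [LinearMap.add_apply, LinearMap.smul_apply, map_sub, map_add, map_smul,
      lp.coeFn_sub, lp.coeFn_add, lp.coeFn_smul, Pi.sub_apply, Pi.add_apply, Pi.smul_apply,
      smul_eq_mul]
    push_cast
    constructor
    · intro H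
      field_simp at H
      linear_combination H
    · intro H
      field_simp
      linear_combination H
  refine hA.isRieszSpectral_isWellPosed hsimple (fun m n h => ?_) ?_ (ω := a + ρ * C) fun n => ?_
  · have h' : a + ρ * θ m = a + ρ * θ n := Complex.ofReal_injective h
    exact hinj (mul_left_cancel₀ hρ.ne' (add_left_cancel h'))
  · have h1 := Filter.tendsto_atTop_add_const_right _ (-|a|) (hlim.const_mul_atTop hρ)
    refine Filter.tendsto_atTop_mono (fun n => ?_) h1
    rw [Complex.norm_real, Real.norm_eq_abs, ← abs_of_pos hρ, ← abs_mul, abs_of_pos hρ]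
    have := abs_sub_abs_le_abs_sub (ρ * θ n) (-a)
    rw [abs_neg, sub_neg_eq_add, add_comm (ρ * θ n) a] at this
    linarith
  · rw [Complex.ofReal_re]
    have := mul_le_mul_of_nonneg_left (hC n) hρ.le
    linarith
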